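/- Let $k$ be a field, let $\mathfrak g$ be a finitely generated Lie algebra over $k$, let $n$ be a natural number, and let $\mathfrak n_n$ be the Lie algebra of strictly upper triangular $n\times n$ matrices. All algebras are commutative. **Filtration and flag representations.** Let $A$ be a $k$-algebra and $r:\mathfrak g_A\to\operatorname{End}_A(E)$ a representation of $\mathfrak g_A=A\otimes_k\mathfrak g$ on an $A$-module $E$. Its associated filtration is $\mathrm{Fil}_0=0$, $\mathrm{Fil}_{i+1}=\{x\in E : r(v)x\in\mathrm{Fil}_i\ \text{for all } v\in\mathfrak g\}$. For a finite locally free $E$ of constant rank $n$, $r$ is *flag* if $\mathrm{Fil}$ is a full flag (each $E/\mathrm{Fil}_i$, $0\le i\le n$, is finite locally free of rank $n-i$) and its formation commutes with every base change $A\to B$. Over a field this says just that $\dim \mathrm{Fil}_i=i$ for $0\le i\le n=\dim E$. **Nondegeneracy over a field.** Let $K\supseteq k$ be a field. An $n$-dimensional representation $r$ of $\mathfrak g_K$ on $E$ is *nondegenerate* if it is flag and, when $n\ge 2$, (i) the representations on $\mathrm{Fil}_{n-1}$ and on $E/\mathrm{Fil}_1$ are nondegenerate, and (ii) the dimension of the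 group scheme $\mathrm{Aut}(r)$ is minimal among all $n$-dimensional flag representations satisfying (i), defined over arbitrary fields containing $k$. **Nondegeneracy in families.** A rank $n$ representation $r$ over a $k$-algebra $A$ is *nondegenerate* if it is flag and, recursively on $n$, (i) when $n\ge1$, the representations on $\mathrm{Fil}_{n-1}$ and on $E/\mathrm{Fil}_1$ are nondegenerate, (ii) for every point $t\in\operatorname{Spec}A$ the fiber of $r$ over the residue field $\kappa(t)$ is nondegenerate, and (iii) the group scheme $\mathrm{Aut}(r)$ of automorphisms of $r$ is flat over $\operatorname{Spec}A$. Let $X_n$ be the $k$-scheme representing the functor $B\mapsto \operatorname{Hom}_{\mathrm{Lie}}(\mathfrak g_B,\mathfrak n_{n}(B))$ on $k$-algebras, and let $X_n^{\mathrm{nd}}\subset X_n^{\mathrm{fl}}\subset X_n$ be the loci of those $B$-points whose induced representation on $B^n$ is nondegenerate, respectively flag. **Proposition.** $X_n$ is representable by a $k$-scheme, $X_n^{\mathrm{fl}}$ is represented by an open subscheme of $X_n$, and the inclusion $X_n^{\mathrm{nd}}\hookrightarrow X_n^{\mathrm{fl}}$ is an immersion: $X_n^{\mathrm{nd}}$ is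 represented by a locally closed subscheme of $X_n^{\mathrm{fl}}$. In particular $X_n^{\mathrm{nd}}$ is representable by a quasi-projective $k$-scheme (one admitting an immersion over $k$ into some $\mathbb P^N_k$). -/

import Mathlib

open CategoryTheory AlgebraicGeometry TensorProduct

universe u v

attribute [local instance 100] LieRing.ofAssociativeRing
attribute [local instance] MvPolynomial.gradedAlgebra

namespace NilpRep

section Representations

variable {k : Type u} [Field k] {g : Type v} [LieRing g] [LieAlgebra k g]
variable {A : Type u} [CommRing A] [Algebra k A]
variable {E : Type u} [AddCommGroup E] [Module A E] [Module k E] [IsScalarTower k A E]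

/-- Restriction of a representation to a stable submodule. A representation of the Lie algebra
`A ⊗ g` on an `A`-module `E` is given as a `k`-linear Lie algebra map from `g` to the `A`-linear
endomorphisms of `E`. -/
def subRep (ρ : g →ₗ⁅k⁆ Module.End A E) (N : Submodule A E)
    (h : ∀ v, ∀ x ∈ N, ρ v x ∈ N) : g →ₗ⁅k⁆ Module.End A N where
  toFun v := (ρ v).restrict (h v)
  map_add' v w := by ext x; simp
  map_smul' c v := by ext x; simp
  map_lie' {v w} := by ext x; simp [LieRing.of_associative_ring_bracket]

/-- The representation induced on the quotient by a stable submodule. -/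
def quotRep (ρ : g →ₗ⁅k⁆ Module.End A E) (N : Submodule A E)
    (h : ∀ v, ∀ x ∈ N, ρ v x ∈ N) : g →ₗ⁅k⁆ Module.End A (E ⧸ N) where
  toFun v := N.mapQ N (ρ v) (h v)
  map_add' v w := by ext x; simp
  map_smul' c v := by ext x; simp
  map_lie' {v w} := by ext x; simp [LieRing.of_associative_ring_bracket]

/-- Base change of a representation along `A → B`. -/
noncomputable def baseChangeRep (ρ : g →ₗ⁅k⁆ Module.End A E)
    (B : Type u) [CommRing B] [Algebra k B] [Algebra A B] [IsScalarTower k A B] :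
    g →ₗ⁅k⁆ Module.End B (B ⊗[A] E) where
  toFun v := (ρ v).baseChange B
  map_add' v w := by simp
  map_smul' c v := by
    refine LinearMap.ext fun x => ?_
    induction x using TensorProduct.induction_on with
    | zero => simp
    | add x y hx hy => rw [map_add, map_add, hx, hy]
    | tmul b e =>
      rw [map_smul]
      change b ⊗ₜ[A] (c • ρ v) e = c • (b ⊗ₜ[A] ρ v e)
      rw [LinearMap.smul_apply, TensorProduct.smul_tmul', ← algebraMap_smul A c (ρ v e),
        ← TensorProduct.smul_tmul, algebraMap_smul]
  map_lie' {v w} := by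
    simp [LieRing.of_associative_ring_bracket, LinearMap.baseChange_sub,
      LinearMap.baseChange_mul]

/-- The associated filtration: `Fil 0 = 0`, and `Fil (i + 1)` is the preimage in `E` of the
submodule of `E / Fil i` killed by `g`. -/
def fil (ρ : g →ₗ⁅k⁆ Module.End A E) : ℕ → Submodule A E
  | 0 => ⊥
  | i + 1 => ⨅ v : g, (fil ρ i).comap (ρ v)

theorem mem_fil_succ (ρ : g →ₗ⁅k⁆ Module.End A E) (i : ℕ) (x : E) :
    x ∈ fil ρ (i + 1) ↔ ∀ v, ρ v x ∈ fil ρ i := by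
  simp [fil]

theorem fil_le_succ (ρ : g →ₗ⁅k⁆ Module.End A E) (i : ℕ) : fil ρ i ≤ fil ρ (i + 1) := by
  induction i with
  | zero => simp [fil]
  | succ i ih =>
    intro x hx
    rw [mem_fil_succ] at hx ⊢
    exact fun v => ih (hx v)

theorem fil_stable (ρ : g →ₗ⁅k⁆ Module.End A E) (i : ℕ) :
    ∀ v, ∀ x ∈ fil ρ i, ρ v x ∈ fil ρ i := fun v x hx =>
  (mem_fil_succ ρ i x).1 (fil_le_succ ρ i hx) v

/-- The subrepresentation on `Fil i`. -/
def filSub (ρ : g →ₗ⁅k⁆ Module.End A E) (i : ℕ) : g →ₗ⁅k⁆ Module.End A (fil ρ i) :=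
  subRep ρ (fil ρ i) (fil_stable ρ i)

/-- The quotient representation on `E / Fil i`. -/
def filQuot (ρ : g →ₗ⁅k⁆ Module.End A E) (i : ℕ) : g →ₗ⁅k⁆ Module.End A (E ⧸ fil ρ i) :=
  quotRep ρ (fil ρ i) (fil_stable ρ i)

/-- A flag representation of rank `n` in a family: `E` is finite locally free of rank `n`, the
associated filtration is a full flag of submodules with locally free quotients (`E / Fil i` is
finite locally free of rank `n - i`, so that `Fil n = E` and the successive quotients are
invertible), and its formation commutes with every base change. -/
def IsFlag (n : ℕ) (ρ : g →ₗ⁅k⁆ Module.End A E) : Prop :=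
  (Module.Finite A E ∧ Module.Projective A E ∧
    ∀ p : PrimeSpectrum A, Module.rankAtStalk E p = n) ∧
  (∀ i : ℕ, Module.Finite A (E ⧸ fil ρ i) ∧ Module.Projective A (E ⧸ fil ρ i) ∧
    ∀ p : PrimeSpectrum A, Module.rankAtStalk (E ⧸ fil ρ i) p = n - i) ∧
  (∀ (B : Type u) [CommRing B] [Algebra k B] [Algebra A B] [IsScalarTower k A B] (i : ℕ),
    fil (baseChangeRep ρ B) i = (fil ρ i).baseChange B)

/-- A flag representation of dimension `n` over a field: the associated filtration is a full
flag. -/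
def IsFlagOverField {K V : Type u} [Field K] [Algebra k K] [AddCommGroup V] [Module K V]
    [Module k V] [IsScalarTower k K V] (n : ℕ) (ρ : g →ₗ⁅k⁆ Module.End K V) : Prop :=
  FiniteDimensional K V ∧ Module.finrank K V = n ∧
    ∀ i ≤ n, Module.finrank K (fil ρ i) = i

/-- The automorphisms of the base change of a representation to `B`: the value at `B` of the
functor of automorphisms. -/
def RepAut (ρ : g →ₗ⁅k⁆ Module.End A E) (B : Type u) [CommRing B] [Algebra A B] : Type u :=
  {φ : (B ⊗[A] E) ≃ₗ[B] (B ⊗[A] E) //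
    ∀ (v : g) (x : B ⊗[A] E), φ ((ρ v).baseChange B x) = (ρ v).baseChange B (φ x)}

/-- `Spec R` represents the group scheme of automorphisms of `ρ` over `Spec A`: there is a
universal automorphism over `R`, from which every automorphism `ψ` over an `A`-algebra `B` arises
by base change along a unique `R → B`. -/
def IsAutRing (ρ : g →ₗ⁅k⁆ Module.End A E) (R : Type u) [CommRing R] [Algebra A R] : Prop :=
  ∃ φ : RepAut ρ R, ∀ (B : Type u) [CommRing B] [Algebra A B] (ψ : RepAut ρ B),
    ∃! f : R →ₐ[A] B, ∀ x : R ⊗[A] E,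
      ψ.1 (f.toLinearMap.rTensor E x) = f.toLinearMap.rTensor E (φ.1 x)

/-- The group scheme of automorphisms of `ρ` is flat over `Spec A`. -/
def AutFlat (ρ : g →ₗ⁅k⁆ Module.End A E) : Prop :=
  ∃ (R : Type u) (_ : CommRing R) (_ : Algebra A R), IsAutRing ρ R ∧ Module.Flat A R

/-- The group scheme of automorphisms of `ρ` has dimension `d`. -/
def HasAutDim (ρ : g →ₗ⁅k⁆ Module.End A E) (d : WithBot ℕ∞) : Prop :=
  ∃ (R : Type u) (_ : CommRing R) (_ : Algebra A R), IsAutRing ρ R ∧ ringKrullDim R = d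

end Representations

section Nondegenerate

variable (k : Type u) [Field k] (g : Type v) [LieRing g] [LieAlgebra k g]

/-- Nondegeneracy of an `n`-dimensional representation `ρ` over a field `K` containing `k`: `ρ` is
flag; if `n = 1` it is trivial; if `n ≥ 2` then (i) the representations on `Fil (n - 1)` and on the
quotient by `Fil 1` are nondegenerate, and (ii) the dimension of the automorphism group scheme is
minimal among all `n`-dimensional flag representations, over fields containing `k`, that
satisfy (i). -/
def IsNondegOverField : (n : ℕ) → (K V : Type u) → [Field K] → [Algebra k K] →
    [AddCommGroup V] → [Module K V] → [Module k V] → [IsScalarTower k K V] →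
    (g →ₗ⁅k⁆ Module.End K V) → Prop
  | 0, _, _, _, _, _, _, _, _, ρ => IsFlagOverField 0 ρ
  | 1, _, _, _, _, _, _, _, _, ρ => IsFlagOverField 1 ρ ∧ ρ = 0
  | n + 2, K, V, _, _, _, _, _, _, ρ =>
    (IsFlagOverField (n + 2) ρ ∧
      IsNondegOverField (n + 1) K (fil ρ (n + 1)) (filSub ρ (n + 1)) ∧
      IsNondegOverField (n + 1) K (V ⧸ fil ρ 1) (filQuot ρ 1)) ∧
    ∃ d : WithBot ℕ∞, HasAutDim ρ d ∧
      ∀ (K' V' : Type u) [Field K'] [Algebra k K'] [AddCommGroup V'] [Module K' V']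
        [Module k V'] [IsScalarTower k K' V'] (ρ' : g →ₗ⁅k⁆ Module.End K' V') (d' : WithBot ℕ∞),
        IsFlagOverField (n + 2) ρ' →
        IsNondegOverField (n + 1) K' (fil ρ' (n + 1)) (filSub ρ' (n + 1)) →
        IsNondegOverField (n + 1) K' (V' ⧸ fil ρ' 1) (filQuot ρ' 1) →
        HasAutDim ρ' d' → d ≤ d'

/-- Nondegeneracy of a rank `n` representation `ρ` over a `k`-algebra `A`: `ρ` is flag,
(i) the representations on `Fil (n - 1)` and on the quotient by `Fil 1` are nondegenerate
(if `n ≥ 1`), (ii) all fibers of `ρ` are nondegenerate, and (iii) the group scheme of automorphisms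
of `ρ` is flat. -/
def IsNondeg : (n : ℕ) → (A E : Type u) → [CommRing A] → [Algebra k A] →
    [AddCommGroup E] → [Module A E] → [Module k E] → [IsScalarTower k A E] →
    (g →ₗ⁅k⁆ Module.End A E) → Prop
  | 0, A, E, _, _, _, _, _, _, ρ =>
    IsFlag 0 ρ ∧
    (∀ p : PrimeSpectrum A, IsNondegOverField k g 0 p.asIdeal.ResidueField
      (p.asIdeal.ResidueField ⊗[A] E) (baseChangeRep ρ p.asIdeal.ResidueField)) ∧
    AutFlat ρ
  | n + 1, A, E, _, _, _, _, _, _, ρ =>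
    IsFlag (n + 1) ρ ∧
    (IsNondeg n A (fil ρ n) (filSub ρ n) ∧ IsNondeg n A (E ⧸ fil ρ 1) (filQuot ρ 1)) ∧
    (∀ p : PrimeSpectrum A, IsNondegOverField k g (n + 1) p.asIdeal.ResidueField
      (p.asIdeal.ResidueField ⊗[A] E) (baseChangeRep ρ p.asIdeal.ResidueField)) ∧
    AutFlat ρ

end Nondegenerate

section Matrices

variable (k : Type u) [Field k]

/-- The Lie algebra of strictly upper triangular `n × n` matrices over a `k`-algebra `B`. -/
def strictUpper (n : ℕ) (B : Type u) [CommRing B] [Algebra k B] :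
    LieSubalgebra k (Matrix (Fin n) (Fin n) B) where
  carrier := {M | ∀ i j, j ≤ i → M i j = 0}
  add_mem' {M N} hM hN i j h := by simp [hM i j h, hN i j h]
  zero_mem' i j _ := rfl
  smul_mem' c M hM i j h := by simp [hM i j h]
  lie_mem' {M N} hM hN i j h := by
    have key : ∀ P Q : Matrix (Fin n) (Fin n) B, (∀ i j, j ≤ i → P i j = 0) →
        (∀ i j, j ≤ i → Q i j = 0) → (P * Q) i j = 0 := by
      intro P Q hP hQ
      rw [Matrix.mul_apply]
      refine Finset.sum_eq_zero fun l _ => ?_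
      rcases le_total l i with hl | hl
      · rw [hP i l hl, zero_mul]
      · rw [hQ l j (h.trans hl), mul_zero]
    rw [LieRing.of_associative_ring_bracket, Matrix.sub_apply, key M N hM hN, key N M hN hM,
      sub_zero]

variable (g : Type v) [LieRing g] [LieAlgebra k g]

/-- The `B`-points of `Hom_Lie(g, n_n)`: Lie algebra maps from `g` to the strictly upper triangular
matrices over `B` (equivalently, `B`-linear Lie algebra maps from `B ⊗ g`). -/
abbrev HomPts (n : ℕ) (B : Type u) [CommRing B] [Algebra k B] : Type (max u v) :=
  g →ₗ⁅k⁆ strictUpper k n B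

variable {k g}

/-- Functoriality of `Hom_Lie(g, n_n)`: apply a ring map to all matrix entries. -/
def HomPts.map {n : ℕ} {B C : Type u} [CommRing B] [Algebra k B] [CommRing C] [Algebra k C]
    (φ : B →ₐ[k] C) (r : HomPts k g n B) : HomPts k g n C where
  toFun v := ⟨(r v).1.map φ, fun i j h => by simp [(r v).2 i j h]⟩
  map_add' v w := by ext i j; simp
  map_smul' c v := by ext i j; simp
  map_lie' {v w} := by
    ext i j
    simp [LieRing.of_associative_ring_bracket, Matrix.mul_apply]

/-- The representation on `B ^ n` (column vectors) given by a `B`-point of `Hom_Lie(g, n_n)`. -/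
def HomPts.toRep {n : ℕ} {B : Type u} [CommRing B] [Algebra k B] (r : HomPts k g n B) :
    g →ₗ⁅k⁆ Module.End B (Fin n → B) where
  toFun v := Matrix.toLin' (r v).1
  map_add' v w := by simp
  map_smul' c v := by
    ext i j
    simp
  map_lie' {v w} := by
    simp [LieRing.of_associative_ring_bracket, Module.End.mul_eq_comp, Matrix.toLin'_mul]

end Matrices

section Schemes

variable (k : Type u) [Field k]

/-- `Spec B` as a `k`-scheme. -/
noncomputable abbrev specOver (B : Type u) [CommRing B] [Algebra k B] :
    Over (Spec (CommRingCat.of k)) :=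
  Over.mk (Spec.map (CommRingCat.ofHom (algebraMap k B)))

variable {k}

/-- The morphism of `k`-schemes induced by a map of `k`-algebras. -/
noncomputable def specOverMap {B C : Type u} [CommRing B] [Algebra k B] [CommRing C] [Algebra k C]
    (φ : B →ₐ[k] C) : specOver k C ⟶ specOver k B :=
  Over.homMk (Spec.map (CommRingCat.ofHom φ.toRingHom)) (by
    simp only [Over.mk_left, Over.mk_hom, ← Spec.map_comp, ← CommRingCat.ofHom_comp]
    congr 2
    exact φ.comp_algebraMap)

/-- A representation of the functor `B ↦ Hom_Lie(g, n_n)(B)` on `k`-algebras by a `k`-scheme `X`. -/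
structure HomPtsRepr (g : Type v) [LieRing g] [LieAlgebra k g] (n : ℕ)
    (X : Over (Spec (CommRingCat.of k))) where
  /-- The bijection between points of `X` and representations. -/
  equiv : ∀ (B : Type u) [CommRing B] [Algebra k B], (specOver k B ⟶ X) ≃ HomPts k g n B
  /-- It is natural. -/
  naturality : ∀ (B C : Type u) [CommRing B] [Algebra k B] [CommRing C] [Algebra k C]
    (φ : B →ₐ[k] C) (f : specOver k B ⟶ X),
    equiv C (specOverMap φ ≫ f) = (equiv B f).map φ

/-- A monomorphism `j : Y ⟶ X` of `k`-schemes represents the locus in `X` where a condition `P` on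
affine points of `X` holds: for every `k`-algebra `B`, a `B`-point of `X` satisfies `P` if and only
if it factors through `j`. -/
def RepresentsLocus {X Y : Over (Spec (CommRingCat.of k))} (j : Y ⟶ X)
    (P : ∀ (B : Type u) [CommRing B] [Algebra k B], (specOver k B ⟶ X) → Prop) : Prop :=
  ∀ (B : Type u) [CommRing B] [Algebra k B] (f : specOver k B ⟶ X),
    P B f ↔ ∃ h : specOver k B ⟶ Y, h ≫ j = f

variable (k) in
/-- Projective `N`-space over `k`, as a `k`-scheme. -/
noncomputable def projSpace (N : ℕ) : Over (Spec (CommRingCat.of k)) :=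
  Over.mk (Proj.toSpecZero (MvPolynomial.homogeneousSubmodule (Fin (N + 1)) k) ≫
    Spec.map (CommRingCat.ofHom
      (algebraMap k (MvPolynomial.homogeneousSubmodule (Fin (N + 1)) k 0))))

/-- A `k`-scheme is quasi-projective if it admits an immersion over `k` into some projective
space. -/
def IsQuasiProjective (Z : Over (Spec (CommRingCat.of k))) : Prop :=
  ∃ (N : ℕ) (i : Z ⟶ projSpace k N), IsImmersion i.left

end Schemes

end NilpRep

/-! The automorphisms of the representation given by a matrix point are the invertible solutions `y`
of the linear system `y * ν s = ν s * y`, where `s` runs through finitely many generators of the Lie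
algebra. The solutions with values in an algebra are the linear maps out of `CommMod`, the cokernel
attached to the coefficient matrix `commMat`, so Aut is the principal open subset where the
determinant is invertible in the spectrum of the symmetric algebra of `CommMod`. Hence Aut is flat
if and only if `CommMod` is projective: first order deformations of the identity make `CommMod` a
retract of the coordinate ring, and conversely the symmetric algebra of a projective module is flat
(`flat_autRing_iff`). Over a field, Aut is a basic open subset of an affine space containing the
identity, so its dimension is that of `CommMod` (`ringKrullDim_autRing`).

Flatness together with minimality of the fiber dimension therefore says that the cokernel is
projective with all fibers of the minimal dimension `d`. Put `c = n * n - d`. By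
`regular_and_finrank_iff` this means that the minors of size `c` generate the unit ideal (an open
condition) and that all Schur complements of such minors vanish (a closed condition). Both are
compatible with base change.

The associated filtration always contains the standard flag, and the representation is flag exactly
when the two agree. By induction along the flag this is injectivity on all fibers of the matrices
`flagMat`, hence open (`isFlag_iff`). For a flag point the representations on `Fil (n - 1)` and on
the quotient by `Fil 1` are the upper left and lower right blocks, so the conditions accumulate by
recursion on the size: `exists_ideals_isNondeg` yields ideals `I` and `J` such that a point over `C`
is nondegenerate if and only if `I` extends to zero and `J` to the unit ideal of `C`.

Finite generation makes the functor of points representable by an algebra `R` of finite type.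
Applied to its universal point, the ideals describe a locally closed subscheme of `Spec R`. It lies
in the open flag locus, and `Spec R` embeds in a projective space. -/

namespace NilpRep

/-! ### Minors, Schur complements and matrices of constant rank -/

section Minors

open Matrix

/-- The ideal generated by the minors of size `c`. -/
def minorIdeal {ι N B : Type*} [CommRing B] (T : Matrix ι N B) (c : ℕ) : Ideal B :=
  Ideal.span (Set.range fun x : (Fin c → ι) × (Fin c → N) => (T.submatrix x.1 x.2).det)

/-- A generalized Schur complement, cleared of denominators. -/
def schur {ι N B : Type*} [CommRing B] (T : Matrix ι N B) {c : ℕ} (e : Fin c → ι)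
    (f : Fin c → N) : Matrix ι N B :=
  (T.submatrix e f).det • T - T.submatrix id f * ((T.submatrix e f).adjugate * T.submatrix e id)

/-- The ideal generated by the entries of all Schur complements of minors of size `c`. -/
def schurIdeal {ι N B : Type*} [CommRing B] (T : Matrix ι N B) (c : ℕ) : Ideal B :=
  Ideal.span (Set.range fun x : ((Fin c → ι) × (Fin c → N)) × ι × N =>
    schur T x.1.1 x.1.2 x.2.1 x.2.2)

variable {ι N : Type*} {B C : Type*} [CommRing B] [CommRing C]

theorem schurIdeal_eq_bot_iff (T : Matrix ι N B) (c : ℕ) :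
    schurIdeal T c = ⊥ ↔ ∀ (e : Fin c → ι) (f : Fin c → N), schur T e f = 0 := by
  rw [schurIdeal, Ideal.span_eq_bot]
  constructor
  · intro h e f
    ext i j
    exact h _ ⟨((e, f), i, j), rfl⟩
  · rintro h _ ⟨x, rfl⟩
    simp [h]

theorem map_minorIdeal (φ : B →+* C) (T : Matrix ι N B) (c : ℕ) :
    (minorIdeal T c).map φ = minorIdeal (T.map φ) c := by
  rw [minorIdeal, minorIdeal, Ideal.map_span, ← Set.range_comp]
  congr 2
  funext x
  simp [RingHom.map_det, RingHom.mapMatrix_apply, Matrix.submatrix_map]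

theorem schur_map (φ : B →+* C) (T : Matrix ι N B) {c : ℕ} (e : Fin c → ι) (f : Fin c → N) :
    schur (T.map φ) e f = (schur T e f).map φ := by
  have h := RingHom.map_adjugate φ (T.submatrix e f)
  have h' := RingHom.map_det φ (T.submatrix e f)
  simp only [RingHom.mapMatrix_apply] at h h'
  simp only [schur, submatrix_map, ← h, ← h', ← Matrix.map_mul, Matrix.map_sub _ (map_sub φ)]
  congr 1
  ext i j
  simp

theorem map_schurIdeal (φ : B →+* C) (T : Matrix ι N B) (c : ℕ) :
    (schurIdeal T c).map φ = schurIdeal (T.map φ) c := by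
  rw [schurIdeal, schurIdeal, Ideal.map_span, ← Set.range_comp]
  congr 2
  funext x
  simp [schur_map]

/-- The Schur complements vanish for a matrix factoring through a free module of rank `c`. -/
theorem schur_mul_eq_zero {c : ℕ} (P : Matrix ι (Fin c) B) (Q : Matrix (Fin c) N B)
    (e : Fin c → ι) (f : Fin c → N) : schur (P * Q) e f = 0 := by
  have h1 : (P * Q).submatrix e f = P.submatrix e id * Q.submatrix id f := rfl
  have h2 : (P * Q).submatrix id f = P * Q.submatrix id f := rfl
  have h3 : (P * Q).submatrix e id = P.submatrix e id * Q := rfl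
  set p := P.submatrix e id
  set q := Q.submatrix id f
  rw [schur, h1, h2, h3, Matrix.adjugate_mul_distrib, Matrix.det_mul]
  -- The adjugates meet `q` and `p` in the middle, which leaves the scalar `det q * det p`, the
  -- determinant of the chosen minor.
  have : P * q * (q.adjugate * p.adjugate * (p * Q)) =
      P * ((q * q.adjugate) * (p.adjugate * p) * Q) := by
    simp only [Matrix.mul_assoc]
  rw [this, Matrix.mul_adjugate, Matrix.adjugate_mul]
  simp [smul_smul]

/-- Dividing the vanishing Schur complement by the unit minor expresses every row through the chosen
`c` rows. This is a converse to `schur_mul_eq_zero`. -/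
theorem eq_mul_of_schur_eq_zero {T : Matrix ι N B} {c : ℕ} {e : Fin c → ι} {f : Fin c → N}
    (hu : IsUnit (T.submatrix e f).det) (h : schur T e f = 0) :
    ∃ Y : Matrix ι (Fin c) B, T = Y * T.submatrix e id := by
  obtain ⟨μ, hμ⟩ := hu
  refine ⟨(↑μ⁻¹ : B) • (T.submatrix id f * (T.submatrix e f).adjugate), ?_⟩
  rw [schur, sub_eq_zero, ← hμ] at h
  rw [Matrix.smul_mul, Matrix.mul_assoc, ← h, smul_smul]
  simp

/-- Write `D` for the Schur complement. Its rows are combinations of rows of `T`, so `D * U * T =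
D`; its columns at `f` vanish, so the correction term in the second factor `D` contributes nothing.
-/
theorem schur_mul_mul_schur [Fintype ι] [Fintype N] {T : Matrix ι N B} {U : Matrix N ι B}
    (hU : T * U * T = T) {c : ℕ} (e : Fin c → ι) (f : Fin c → N) :
    schur T e f * U * schur T e f = (T.submatrix e f).det • schur T e f := by
  have he : T.submatrix e id * U * T = T.submatrix e id := by
    conv_rhs => rw [← hU]
    rfl
  have h1 : schur T e f * U * T = schur T e f := by
    rw [schur, Matrix.sub_mul, Matrix.sub_mul, Matrix.smul_mul, Matrix.smul_mul, hU]
    congr 1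
    simp only [Matrix.mul_assoc] at he ⊢
    rw [he]
  have hf : schur T e f * U * T.submatrix id f = 0 := by
    have : schur T e f * U * T.submatrix id f = (schur T e f * U * T).submatrix id f := rfl
    rw [this, h1]
    have h2 : (schur T e f).submatrix id f = (T.submatrix e f).det • T.submatrix id f -
      T.submatrix id f * ((T.submatrix e f).adjugate * T.submatrix e f) := rfl
    rw [h2, Matrix.adjugate_mul]
    simp
  conv_lhs => enter [2]; rw [schur]
  rw [Matrix.mul_sub, Matrix.mul_smul, h1, ← Matrix.mul_assoc, hf, Matrix.zero_mul, sub_zero]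

/-- Over a local ring, a von Neumann regular matrix whose Schur complement vanishes over the
residue field factors accordingly. -/
theorem schur_eq_zero_of_residue [Fintype ι] [Fintype N] [IsLocalRing B] {T : Matrix ι N B}
    {U : Matrix N ι B} (hU : T * U * T = T) {c : ℕ} {e : Fin c → ι} {f : Fin c → N}
    (hu : IsUnit (T.submatrix e f).det)
    (h : (schur T e f).map (IsLocalRing.residue B) = 0) : schur T e f = 0 := by
  classical
  set D := schur T e f
  set μ := (T.submatrix e f).det
  -- A Nakayama argument: `D` is killed by a matrix congruent to the unit scalar `μ` modulo the
  -- maximal ideal, and such a matrix is invertible.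
  have key : (μ • (1 : Matrix ι ι B) - D * U) * D = 0 := by
    rw [Matrix.sub_mul, schur_mul_mul_schur hU, Matrix.smul_mul, Matrix.one_mul, sub_self]
  have hdet : IsUnit (μ • (1 : Matrix ι ι B) - D * U).det := by
    rw [← IsLocalRing.residue_ne_zero_iff_isUnit, RingHom.map_det, RingHom.mapMatrix_apply,
      Matrix.map_sub _ (map_sub _), Matrix.map_mul, h, Matrix.zero_mul, sub_zero]
    have h1 : (μ • (1 : Matrix ι ι B)).map (IsLocalRing.residue B) =
        (IsLocalRing.residue B μ) • 1 := by
      ext i j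
      by_cases hij : i = j <;> simp [hij]
    rw [h1, Matrix.det_smul, Matrix.det_one, mul_one]
    exact pow_ne_zero _ ((IsLocalRing.residue_ne_zero_iff_isUnit _).2 hu)
  have := congrArg (fun X => (μ • (1 : Matrix ι ι B) - D * U)⁻¹ * X) key
  simpa only [← Matrix.mul_assoc, Matrix.nonsing_inv_mul _ hdet, Matrix.one_mul,
    Matrix.mul_zero] using this

theorem exists_linearIndependent_comp {K V : Type*} [Field K] [AddCommGroup V] [Module K V]
    [FiniteDimensional K V] (t : ι → V) {c : ℕ}
    (hc : Module.finrank K (Submodule.span K (Set.range t)) = c) :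
    ∃ e : Fin c → ι, LinearIndependent K (t ∘ e) := by
  obtain ⟨b, hb, hspan, hli⟩ := exists_linearIndependent K (Set.range t)
  have hfin : Finite b := hli.finite
  have := Fintype.ofFinite b
  have hcard : Fintype.card b = Module.finrank K (Submodule.span K (Set.range t)) := by
    rw [← hspan, ← finrank_span_eq_card hli, Subtype.range_coe]
  rw [← hc, ← hcard]
  choose g hg using fun x : b => hb x.2
  refine ⟨g ∘ (Fintype.equivFin b).symm, ?_⟩
  have : t ∘ g ∘ (Fintype.equivFin b).symm = Subtype.val ∘ (Fintype.equivFin b).symm := by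
    funext x
    simp [hg]
  rw [this]
  exact hli.comp _ (Equiv.injective _)

section Field

variable {K : Type*} [Field K]

/-- Over a field, a matrix with rows spanning a space of dimension `c` has an invertible minor of
size `c`. -/
theorem exists_det_ne_zero [Finite N] (T : Matrix ι N K) {c : ℕ}
    (hc : Module.finrank K (Submodule.span K (Set.range T.row)) = c) :
    ∃ (e : Fin c → ι) (f : Fin c → N), (T.submatrix e f).det ≠ 0 := by
  have := Fintype.ofFinite N
  obtain ⟨e, he⟩ := exists_linearIndependent_comp T.row hc
  have hS : (T.submatrix e id).rank = c := by
    rw [LinearIndependent.rank_matrix (M := T.submatrix e id) (by exact he), Fintype.card_fin]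
  have hS' : Module.finrank K (Submodule.span K (Set.range (T.submatrix e id).col)) = c := by
    rw [← Matrix.rank_eq_finrank_span_cols, hS]
  obtain ⟨f, hf⟩ := exists_linearIndependent_comp (T.submatrix e id).col hS'
  have hf' : LinearIndependent K (T.submatrix e f).col := hf
  rw [Matrix.linearIndependent_cols_iff_isUnit, Matrix.isUnit_iff_isUnit_det] at hf'
  exact ⟨e, f, hf'.ne_zero⟩

theorem linearIndependent_rows_of_det_ne_zero {T : Matrix ι N K} {c : ℕ} {e : Fin c → ι}
    {f : Fin c → N} (h : (T.submatrix e f).det ≠ 0) : LinearIndependent K (T.submatrix e id).row := by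
  have h1 : LinearIndependent K (T.submatrix e f).row := by
    rw [Matrix.linearIndependent_rows_iff_isUnit, Matrix.isUnit_iff_isUnit_det]
    exact h.isUnit
  exact LinearIndependent.of_comp (LinearMap.funLeft K K f) h1

/-- The rows of a nonzero minor are independent and there are as many as the rank, so they span the
row space and the matrix factors through them. -/
theorem schur_eq_zero_of_finrank [Finite N] {T : Matrix ι N K} {c : ℕ}
    (hc : Module.finrank K (Submodule.span K (Set.range T.row)) = c) {e : Fin c → ι}
    {f : Fin c → N} (h : (T.submatrix e f).det ≠ 0) : schur T e f = 0 := by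
  have hle : Submodule.span K (Set.range (T.submatrix e id).row) ≤
      Submodule.span K (Set.range T.row) := by
    refine Submodule.span_mono ?_
    rintro _ ⟨i, rfl⟩
    exact ⟨e i, rfl⟩
  have heq := Submodule.eq_of_le_of_finrank_eq hle (by
    rw [hc, finrank_span_eq_card (linearIndependent_rows_of_det_ne_zero h), Fintype.card_fin])
  have hrow : ∀ i, ∃ y : Fin c → K, ∑ a, y a • (T.submatrix e id).row a = T.row i := fun i => by
    rw [← Submodule.mem_span_range_iff_exists_fun, heq]
    exact Submodule.subset_span ⟨i, rfl⟩
  choose Y hY using hrow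
  have hT : T = Matrix.of Y * T.submatrix e id := by
    ext i j
    have := congrFun (hY i) j
    simp only [Finset.sum_apply, Pi.smul_apply, Matrix.row_apply, smul_eq_mul] at this
    rw [Matrix.mul_apply, ← this]
    rfl
  rw [hT]
  exact schur_mul_eq_zero _ _ _ _

theorem finrank_of_minorIdeal [Finite N] {T : Matrix ι N K} {c : ℕ} (h1 : minorIdeal T c = ⊤)
    (h2 : schurIdeal T c = ⊥) : Module.finrank K (Submodule.span K (Set.range T.row)) = c := by
  obtain ⟨e, f, h⟩ : ∃ (e : Fin c → ι) (f : Fin c → N), (T.submatrix e f).det ≠ 0 := by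
    by_contra! hcon
    have : minorIdeal T c = ⊥ := by
      rw [minorIdeal, Ideal.span_eq_bot]
      rintro _ ⟨x, rfl⟩
      exact hcon _ _
    exact bot_ne_top (this.symm.trans h1)
  obtain ⟨Y, hY⟩ := eq_mul_of_schur_eq_zero h.isUnit ((schurIdeal_eq_bot_iff T c).1 h2 e f)
  have heq : Submodule.span K (Set.range T.row) =
      Submodule.span K (Set.range (T.submatrix e id).row) := by
    refine le_antisymm (Submodule.span_le.2 ?_) (Submodule.span_mono ?_)
    · rintro _ ⟨i, rfl⟩
      rw [SetLike.mem_coe, Submodule.mem_span_range_iff_exists_fun]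
      refine ⟨Y i, ?_⟩
      ext j
      have := congrFun (congrFun hY i) j
      rw [Matrix.row_apply, this, Matrix.mul_apply]
      simp
    · rintro _ ⟨i, rfl⟩
      exact ⟨e i, rfl⟩
  rw [heq, finrank_span_eq_card (linearIndependent_rows_of_det_ne_zero h), Fintype.card_fin]

theorem minorIdeal_eq_top_of_finrank [Finite N] {T : Matrix ι N K} {c : ℕ}
    (hc : Module.finrank K (Submodule.span K (Set.range T.row)) = c) : minorIdeal T c = ⊤ := by
  obtain ⟨e, f, h⟩ := exists_det_ne_zero T hc
  exact Ideal.eq_top_of_isUnit_mem _ (Ideal.subset_span ⟨(e, f), rfl⟩) h.isUnit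

end Field

/-- A proper ideal lies in a maximal one and dies in its residue field. Open conditions are thereby
checked on fibers. -/
theorem ideal_eq_top_of_residueField {I : Ideal B}
    (h : ∀ p : PrimeSpectrum B, I.map (algebraMap B p.asIdeal.ResidueField) = ⊤) : I = ⊤ := by
  by_contra hI
  obtain ⟨m, hm, hIm⟩ := Ideal.exists_le_maximal I hI
  have h1 := h ⟨m, hm.isPrime⟩
  have h2 : I.map (algebraMap B m.ResidueField) = ⊥ := by
    rw [Ideal.map_eq_bot_iff_le_ker, Ideal.ker_algebraMap_residueField]
    exact hIm
  exact bot_ne_top (h2.symm.trans h1)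

/-- The condition that a matrix is von Neumann regular (its cokernel is projective) of constant
row rank `c` on the fibers is given by equations and invertibility of minors. -/
theorem regular_and_finrank_iff [Fintype ι] [Fintype N] (T : Matrix ι N B) (c : ℕ) :
    ((∃ U : Matrix N ι B, T * U * T = T) ∧ ∀ p : PrimeSpectrum B,
      Module.finrank p.asIdeal.ResidueField (Submodule.span p.asIdeal.ResidueField
        (Set.range (T.map (algebraMap B p.asIdeal.ResidueField)).row)) = c) ↔
    minorIdeal T c = ⊤ ∧ schurIdeal T c = ⊥ := by
  classical
  constructor
  · rintro ⟨⟨U, hU⟩, hr⟩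
    have h1 : minorIdeal T c = ⊤ := ideal_eq_top_of_residueField fun p => by
      rw [map_minorIdeal]
      exact minorIdeal_eq_top_of_finrank (hr p)
    refine ⟨h1, ?_⟩
    rw [schurIdeal_eq_bot_iff]
    intro e' f'
    ext i j
    refine eq_zero_of_localization _ fun m hm => ?_
    let φ := algebraMap B (Localization.AtPrime m)
    change φ _ = 0
    have h2 : minorIdeal (T.map φ) c = ⊤ := by rw [← map_minorIdeal, h1, Ideal.map_top]
    -- In a local ring, elements generating the unit ideal include a unit.
    obtain ⟨e, f, hu⟩ : ∃ (e : Fin c → ι) (f : Fin c → N),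
        IsUnit ((T.map φ).submatrix e f).det := by
      by_contra! hcon
      have : minorIdeal (T.map φ) c ≤ IsLocalRing.maximalIdeal _ := by
        rw [minorIdeal, Ideal.span_le]
        rintro _ ⟨x, rfl⟩
        exact hcon _ _
      exact IsLocalRing.maximalIdeal.isMaximal _ |>.ne_top (top_le_iff.1 (h2 ▸ this))
    have hU' : T.map φ * U.map φ * T.map φ = T.map φ := by
      rw [← Matrix.map_mul, ← Matrix.map_mul, hU]
    -- On the fiber the rank is exactly `c`, so the Schur complement of the nonzero minor vanishes
    -- there; regularity then lifts the vanishing to the local ring.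
    have h3 : (schur (T.map φ) e f).map (IsLocalRing.residue _) = 0 := by
      rw [← schur_map]
      refine schur_eq_zero_of_finrank (hr ⟨m, hm.isPrime⟩) ?_
      rw [← IsLocalRing.residue_ne_zero_iff_isUnit, RingHom.map_det] at hu
      exact hu
    obtain ⟨Y, hY⟩ := eq_mul_of_schur_eq_zero hu (schur_eq_zero_of_residue hU' hu h3)
    -- Locally the matrix now factors through a free module of rank `c`, so the Schur complements of
    -- all its minors vanish, not only that of the invertible one.
    have h4 : schur (T.map φ) e' f' = 0 := by
      rw [hY]
      exact schur_mul_eq_zero _ _ _ _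
    rw [schur_map] at h4
    exact congrFun (congrFun h4 i) j
  · rintro ⟨h1, h2⟩
    refine ⟨?_, fun p => ?_⟩
    · have h3 : (1 : B) ∈ minorIdeal T c := h1 ▸ Submodule.mem_top
      rw [minorIdeal, Ideal.span, Finsupp.mem_span_range_iff_exists_finsupp] at h3
      obtain ⟨a, ha⟩ := h3
      rw [schurIdeal_eq_bot_iff] at h2
      -- Write 1 as the combination of minors with coefficients `a`, and take for `U` the same
      -- combination of adjugates, brought to size `N × ι` by selection matrices. Vanishing of a
      -- Schur complement says that each such adjugate, multiplied by `T` on both sides, gives its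
      -- minor times `T`.
      refine ⟨a.sum fun x b => b • ((1 : Matrix N N B).submatrix id x.2 *
        ((T.submatrix x.1 x.2).adjugate * (1 : Matrix ι ι B).submatrix x.1 id)), ?_⟩
      rw [Finsupp.sum, Matrix.mul_sum, Matrix.sum_mul]
      have h4 : ∀ x ∈ a.support, T * (a x • ((1 : Matrix N N B).submatrix id x.2 *
          ((T.submatrix x.1 x.2).adjugate * (1 : Matrix ι ι B).submatrix x.1 id))) * T =
          (a x • (T.submatrix x.1 x.2).det) • T := by
        intro x _
        have h5 := h2 x.1 x.2
        rw [schur, sub_eq_zero] at h5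
        rw [smul_assoc, h5, Matrix.mul_smul, Matrix.smul_mul]
        congr 1
        have h6 : T * (1 : Matrix N N B).submatrix id x.2 = T.submatrix id x.2 := by
          ext a b; simp [Matrix.mul_apply, Matrix.one_apply]
        have h7 : (1 : Matrix ι ι B).submatrix x.1 id * T = T.submatrix x.1 id := by
          ext a b; simp [Matrix.mul_apply, Matrix.one_apply]
        rw [← Matrix.mul_assoc, h6, Matrix.mul_assoc, Matrix.mul_assoc, h7]
      rw [Finset.sum_congr rfl h4, ← Finset.sum_smul]
      have h8 : ∑ x ∈ a.support, a x • (T.submatrix x.1 x.2).det = 1 := ha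
      rw [h8, one_smul]
    · refine finrank_of_minorIdeal ?_ ?_
      · rw [← map_minorIdeal, h1, Ideal.map_top]
      · rw [← map_schurIdeal, h2, Ideal.map_bot]

/-- If the maximal minors of a matrix generate the unit ideal, then it has trivial kernel. -/
theorem eq_zero_of_minorIdeal_eq_top [Fintype N] {T : Matrix ι N B}
    (h : minorIdeal T (Fintype.card N) = ⊤) {x : N → B} (hx : ∀ i, T i ⬝ᵥ x = 0) : x = 0 := by
  have hle : minorIdeal T (Fintype.card N) ≤ Module.annihilator B (Submodule.span B {x}) := by
    rw [minorIdeal, Ideal.span_le]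
    rintro _ ⟨⟨e, f⟩, rfl⟩
    rw [SetLike.mem_coe, Submodule.mem_annihilator_span_singleton]
    -- If `f` selects every column once, multiplying by the adjugate shows that the minor kills the
    -- vector; otherwise a column is repeated and the minor is zero.
    by_cases hf : Function.Injective f
    · have hbij : Function.Bijective f :=
        (Fintype.bijective_iff_injective_and_card f).2 ⟨hf, by simp⟩
      have h0 : T.submatrix e f *ᵥ (x ∘ f) = 0 := by
        funext a
        rw [Pi.zero_apply, ← hx (e a)]
        exact hbij.sum_comp fun j => T (e a) j * x j
      have h1 := congrArg (fun y => (T.submatrix e f).adjugate *ᵥ y) h0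
      simp only [Matrix.mulVec_mulVec, Matrix.adjugate_mul, Matrix.mulVec_zero, Matrix.smul_mulVec,
        Matrix.one_mulVec] at h1
      funext j
      obtain ⟨a, rfl⟩ := hbij.2 j
      exact congrFun h1 a
    · obtain ⟨a, b, hab, hne⟩ := by simpa [Function.Injective] using hf
      have h0 : (T.submatrix e f).det = 0 :=
        Matrix.det_zero_of_column_eq hne fun l => by simp [hab]
      exact (congrArg (· • x) h0).trans (zero_smul _ _)
  have h1 : (1 : B) ∈ Module.annihilator B (Submodule.span B {x}) := hle (h ▸ Submodule.mem_top)
  rw [Submodule.mem_annihilator_span_singleton, one_smul] at h1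
  exact h1

/-- If the rows spanned a proper subspace, a nonzero functional would vanish on them, and its
coordinate vector would be a nonzero element of the kernel. -/
theorem minorIdeal_eq_top_of_ker_eq_bot {K : Type*} [Field K] [Fintype N] {T : Matrix ι N K}
    (h : ∀ x : N → K, (∀ i, T i ⬝ᵥ x = 0) → x = 0) : minorIdeal T (Fintype.card N) = ⊤ := by
  classical
  refine minorIdeal_eq_top_of_finrank ?_
  have : Submodule.span K (Set.range T.row) = ⊤ := by
    by_contra hne
    obtain ⟨f, hf, hle⟩ := Submodule.exists_le_ker_of_lt_top _ (lt_top_iff_ne_top.2 hne)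
    have hfx : ∀ y, f y = y ⬝ᵥ fun j => f (Pi.single j 1) := fun y => by
      rw [LinearMap.pi_apply_eq_sum_univ f y]
      simp only [dotProduct, smul_eq_mul]
      refine Finset.sum_congr rfl fun j _ => ?_
      congr 2
      funext l
      simp [Pi.single_apply, eq_comm]
    have hx := h (fun j => f (Pi.single j 1)) fun i => by
      rw [← hfx]
      exact hle (Submodule.subset_span ⟨i, rfl⟩)
    refine hf (LinearMap.ext fun y => ?_)
    rw [hfx, hx]
    simp
  rw [this, finrank_top, Module.finrank_pi]

end Minors
end NilpRep

namespace NilpRep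

/-! ### Dimension of basic open subsets of affine space -/

section KrullDim

variable {K : Type*} [Field K] {d : ℕ}

/-- Specialize the first `m` variables to the coordinates of `a`. -/
noncomputable def specialize (a : Fin d → K) (m : ℕ) :
    MvPolynomial (Fin d) K →ₐ[K] MvPolynomial (Fin d) K :=
  MvPolynomial.aeval fun j => if (j : ℕ) < m then MvPolynomial.C (a j) else MvPolynomial.X j

theorem specialize_comp (a : Fin d → K) {m m' : ℕ} (h : m ≤ m') :
    (specialize a m').comp (specialize a m) = specialize a m' := by
  refine MvPolynomial.algHom_ext fun j => ?_
  simp only [specialize, AlgHom.comp_apply, MvPolynomial.aeval_X]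
  by_cases h1 : (j : ℕ) < m
  · simp [h1, h1.trans_le h]
  · simp [h1]

/-- Specializing only fixes coordinates to the values they have at `a` anyway. Hence a polynomial
not vanishing at `a` stays nonzero under every specialization. -/
theorem eval_specialize (a : Fin d → K) (m : ℕ) (f : MvPolynomial (Fin d) K) :
    MvPolynomial.eval a (specialize a m f) = MvPolynomial.eval a f := by
  have : (MvPolynomial.aeval (R := K) a).comp (specialize a m) = MvPolynomial.aeval a := by
    refine MvPolynomial.algHom_ext fun j => ?_
    simp only [specialize, AlgHom.comp_apply, MvPolynomial.aeval_X]
    split_ifs <;> simp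
  exact DFunLike.congr_fun this f

/-- A nonempty basic open subset of affine space with a rational point has the dimension of the
affine space. -/
theorem ringKrullDim_away_mvPolynomial {f : MvPolynomial (Fin d) K} {a : Fin d → K}
    (hf : MvPolynomial.eval a f ≠ 0) (S : Type*) [CommRing S] [Algebra (MvPolynomial (Fin d) K) S]
    [IsLocalization.Away f S] : ringKrullDim S = d := by
  refine le_antisymm ?_ ?_
  · have h1 : ringKrullDim S ≤ ringKrullDim (MvPolynomial (Fin d) K) := by
      refine Order.krullDim_le_of_strictMono (PrimeSpectrum.comap (algebraMap (MvPolynomial (Fin d) K) S)) ?_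
      refine Monotone.strictMono_of_injective (fun p q hpq => ?_)
        (PrimeSpectrum.localization_comap_injective S (Submonoid.powers f))
      exact Ideal.comap_mono hpq
    rw [MvPolynomial.ringKrullDim_of_isNoetherianRing, ringKrullDim_eq_zero_of_field] at h1
    simpa using h1
  · have hunit : ∀ (m : ℕ) (y : Submonoid.powers f),
        IsUnit (((algebraMap (MvPolynomial (Fin d) K) (FractionRing (MvPolynomial (Fin d) K))).comp (specialize a m).toRingHom) y) := by
      rintro m ⟨_, l, rfl⟩
      simp only [AlgHom.toRingHom_eq_coe, map_pow]
      refine IsUnit.pow _ (IsUnit.mk0 _ ?_)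
      rw [RingHom.comp_apply, Ne, FaithfulSMul.algebraMap_eq_zero_iff]
      intro h0
      apply hf
      rw [← eval_specialize a m]
      exact (congrArg (MvPolynomial.eval a) h0).trans (map_zero _)
    let Ψ : ℕ → S →+* FractionRing (MvPolynomial (Fin d) K) := fun m => IsLocalization.lift (hunit m)
    have hΨ : ∀ m p, Ψ m (algebraMap (MvPolynomial (Fin d) K) S p) = 0 ↔ specialize a m p = 0 := fun m p => by
      rw [IsLocalization.lift_eq, RingHom.comp_apply, FaithfulSMul.algebraMap_eq_zero_iff]
      rfl
    -- The lower bound comes from the flag of linear subspaces through `a`: `Q m` is the generic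
    -- point of the subspace on which the first `m` coordinates agree with those of `a`. It survives
    -- in the localization because `f a ≠ 0`.
    let Q : ℕ → PrimeSpectrum S := fun m => ⟨RingHom.ker (Ψ m), RingHom.ker_isPrime _⟩
    have hQ : StrictMono fun i : Fin (d + 1) => Q i := by
      rw [Fin.strictMono_iff_lt_succ]
      intro i
      refine lt_of_le_of_ne ?_ fun heq => ?_
      · intro z hz
        obtain ⟨⟨p, s⟩, hs⟩ := IsLocalization.surj (Submonoid.powers f) z
        have h0 : specialize a i p = 0 := by
          rw [← hΨ, ← hs, map_mul, (show Ψ i z = 0 from hz), zero_mul]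
        have h1 : Ψ (i + 1) z * Ψ (i + 1) (algebraMap (MvPolynomial (Fin d) K) S s) = 0 := by
          rw [← map_mul, hs, hΨ, ← specialize_comp a (Nat.le_succ i), AlgHom.comp_apply, h0,
            map_zero]
        refine (mul_eq_zero.1 h1).resolve_right ?_
        have := hunit (i + 1) s
        rw [IsLocalization.lift_eq]
        exact this.ne_zero
      -- The inclusion is strict because the equation of the next coordinate lies in the larger
      -- prime only.
      · let z := algebraMap (MvPolynomial (Fin d) K) S (MvPolynomial.X i - MvPolynomial.C (a i))
        have h1 : z ∈ (Q (i.succ : Fin (d + 1))).asIdeal := by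
          change Ψ _ _ = 0
          rw [hΨ]
          simp [specialize]
        have h2 : z ∈ (Q (i.castSucc : Fin (d + 1))).asIdeal := by
          rw [show Q (i.castSucc : Fin (d + 1)) = Q (i.succ : Fin (d + 1)) from heq]
          exact h1
        change Ψ _ _ = 0 at h2
        rw [hΨ] at h2
        simp only [specialize, Fin.val_castSucc, map_sub, MvPolynomial.aeval_X, lt_irrefl,
          if_false, MvPolynomial.algHom_C, MvPolynomial.algebraMap_eq] at h2
        -- At the point with all coordinates shifted by 1 the polynomial takes the value 1, so it is
        -- not zero.
        have h3 := congrArg (MvPolynomial.eval (fun j => a j + 1)) h2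
        simp at h3
    exact Order.le_krullDim_iff.2 ⟨LTSeries.mk d _ hQ, rfl⟩

end KrullDim

/-! ### Projective cokernels and von Neumann regular matrices -/

section RegularMatrix

open Matrix

variable {ι N B : Type*} [CommRing B]

/-- The cokernel of the transpose of a matrix. -/
abbrev rowCoker (T : Matrix ι N B) : Type _ := (N → B) ⧸ Submodule.span B (Set.range T.row)

theorem finrank_rowCoker_add {K : Type*} [Field K] [Fintype N] (T : Matrix ι N K) :
    Module.finrank K (rowCoker T) + Module.finrank K (Submodule.span K (Set.range T.row)) =
      Fintype.card N := by
  rw [Submodule.finrank_quotient_add_finrank, Module.finrank_pi]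

/-- The cokernel of a matrix is flat if and only if the matrix is von Neumann regular. -/
theorem projective_rowCoker_iff [Fintype ι] [Fintype N] (T : Matrix ι N B) :
    Module.Projective B (rowCoker T) ↔ ∃ U : Matrix N ι B, T * U * T = T := by
  classical
  set W := Submodule.span B (Set.range T.row)
  constructor
  · intro h
    -- A section `σ` of the quotient map makes 1 minus `σ` after the quotient map a projector onto
    -- the row space. Writing its values on basis vectors through the rows gives `U` with `U * T`
    -- this projector, which fixes the rows of `T`.
    obtain ⟨σ, hσ⟩ := Module.projective_lifting_property W.mkQ LinearMap.id W.mkQ_surjective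
    have hmem : ∀ x : N → B, x - σ (W.mkQ x) ∈ W := fun x => by
      have h1 := LinearMap.congr_fun hσ (W.mkQ x)
      rw [LinearMap.comp_apply, LinearMap.id_apply] at h1
      rw [← Submodule.Quotient.mk_eq_zero W, ← W.mkQ_apply, map_sub, h1, sub_self]
    have hex : ∀ j : N, ∃ y : ι → B, ∑ i, y i • T.row i =
        Pi.single j 1 - σ (W.mkQ (Pi.single j 1)) := fun j => by
      rw [← Submodule.mem_span_range_iff_exists_fun]
      exact hmem _
    choose U hU using hex
    refine ⟨Matrix.of U, ?_⟩
    ext i j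
    have hUT : ∀ a, (Matrix.of U * T) a = Pi.single a 1 - σ (W.mkQ (Pi.single a 1)) := fun a => by
      rw [← hU]
      ext b
      simp [Matrix.mul_apply]
    rw [Matrix.mul_assoc, Matrix.mul_apply]
    have h1 : ∑ a, T i a • (Matrix.of U * T) a = T i := by
      have h2 : T i = ∑ a, T i a • (Pi.single a 1 : N → B) := pi_eq_sum_univ' (T i)
      have h3 : σ (W.mkQ (T i)) = 0 := by
        rw [show W.mkQ (T i) = 0 from (Submodule.Quotient.mk_eq_zero W).2
          (Submodule.subset_span ⟨i, rfl⟩), map_zero]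
      calc ∑ a, T i a • (Matrix.of U * T) a
          = ∑ a, T i a • (Pi.single a 1 : N → B)
            - σ (W.mkQ (∑ a, T i a • (Pi.single a 1 : N → B))) := by
              simp only [map_sum, map_smul, ← Finset.sum_sub_distrib, ← smul_sub, hUT]
        _ = T i := by rw [← h2, h3, sub_zero]
    have := congrFun h1 j
    simpa using this
  · rintro ⟨U, hU⟩
    -- The complementary projector kills the rows, so it descends to a section of the quotient map.
    let s : (N → B) →ₗ[B] (N → B) := LinearMap.id - (U * T).vecMulLinear
    have hs : W ≤ LinearMap.ker s := by
      rw [Submodule.span_le]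
      rintro _ ⟨i, rfl⟩
      have : T.row i ᵥ* (U * T) = T.row i := by
        conv_rhs => rw [← hU, Matrix.mul_assoc]
        rfl
      simp [s, this]
    refine Module.Projective.of_split (W.liftQ s hs) W.mkQ (LinearMap.ext fun x => ?_)
    obtain ⟨x, rfl⟩ := W.mkQ_surjective x
    change W.mkQ (s x) = W.mkQ x
    rw [W.mkQ_apply, W.mkQ_apply, Submodule.Quotient.eq]
    have h1 : s x - x = - ((x ᵥ* U) ᵥ* T) := by simp [s]
    rw [h1]
    refine W.neg_mem ?_
    rw [Matrix.vecMul_eq_sum]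
    exact W.sum_mem fun i _ => W.smul_mem _ (Submodule.subset_span ⟨i, rfl⟩)

/-- The cokernel is finitely presented, so flat and projective agree. -/
theorem flat_rowCoker_iff [Fintype ι] [Fintype N] (T : Matrix ι N B) :
    Module.Flat B (rowCoker T) ↔ ∃ U : Matrix N ι B, T * U * T = T := by
  rw [← projective_rowCoker_iff]
  refine ⟨fun h => ?_, fun h => inferInstance⟩
  have : Module.FinitePresentation B (rowCoker T) :=
    Module.finitePresentation_of_free_of_surjective (Submodule.mkQ _) (Submodule.mkQ_surjective _)
      (by
        rw [Submodule.ker_mkQ]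
        exact Submodule.fg_span (Set.finite_range _))
  exact Module.Flat.projective_of_finitePresentation

end RegularMatrix

/-- A projective module is a retract of a free one. By functoriality its symmetric algebra is a
retract of that of the free module, which is flat. -/
theorem flat_symmetricAlgebra {B M : Type*} [CommRing B] [AddCommGroup M] [Module B M]
    [Module.Projective B M] : Module.Flat B (SymmetricAlgebra B M) := by
  obtain ⟨s, hs⟩ := Module.projective_def'.1 ‹Module.Projective B M›
  let i := SymmetricAlgebra.lift (SymmetricAlgebra.ι B (M →₀ B) ∘ₗ s)
  let r := SymmetricAlgebra.lift (SymmetricAlgebra.ι B M ∘ₗ Finsupp.linearCombination B id)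
  refine Module.Flat.of_retract (M := SymmetricAlgebra B (M →₀ B)) i.toLinearMap r.toLinearMap ?_
  have : r.comp i = AlgHom.id B _ := by
    refine SymmetricAlgebra.algHom_ext (LinearMap.ext fun m => ?_)
    have := LinearMap.congr_fun hs m
    simp only [LinearMap.comp_apply, LinearMap.id_apply] at this
    simp [i, r, this]
  rw [← AlgHom.comp_toLinearMap, this]
  rfl

end NilpRep

namespace NilpRep

/-! ### The group scheme of invertible matrices in a commutant -/

section Commutant

open Matrix

variable {S : Type*} {n : ℕ} {B : Type u} [CommRing B]

/-- The matrix of the linear equations on `y` expressing that `y` commutes with all `ν s`. -/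
def commMat {B : Type*} [CommRing B] (ν : S → Matrix (Fin n) (Fin n) B) :
    Matrix (S × Fin n × Fin n) (Fin n × Fin n) B :=
  fun x ab => (if ab.1 = x.2.1 then ν x.1 ab.2 x.2.2 else 0) -
    (if ab.2 = x.2.2 then ν x.1 x.2.1 ab.1 else 0)

theorem commMat_map {B C : Type*} [CommRing B] [CommRing C] (φ : B →+* C)
    (ν : S → Matrix (Fin n) (Fin n) B) :
    commMat (fun s => (ν s).map φ) = (commMat ν).map φ := by
  ext x ab
  simp only [commMat, Matrix.map_apply, map_sub]
  split_ifs <;> simp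

theorem sum_commMat_mul (ν : S → Matrix (Fin n) (Fin n) B) (y : Matrix (Fin n) (Fin n) B)
    (x : S × Fin n × Fin n) :
    ∑ ab, commMat ν x ab * y ab.1 ab.2 = (y * ν x.1 - ν x.1 * y) x.2.1 x.2.2 := by
  obtain ⟨s, i, j⟩ := x
  simp only [commMat, sub_mul, Finset.sum_sub_distrib, Matrix.sub_apply, Matrix.mul_apply, ite_mul,
    zero_mul, Fintype.sum_prod_type]
  congr 1
  · rw [Finset.sum_comm]
    simp [mul_comm]
  · simp

theorem sum_commMat_smul {C : Type*} [CommRing C] [Algebra B C]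
    (ν : S → Matrix (Fin n) (Fin n) B) (y : Matrix (Fin n) (Fin n) C) (x : S × Fin n × Fin n) :
    ∑ ab, commMat ν x ab • y ab.1 ab.2 =
      (y * (ν x.1).map (algebraMap B C) - (ν x.1).map (algebraMap B C) * y) x.2.1 x.2.2 := by
  rw [← sum_commMat_mul (fun s => (ν s).map (algebraMap B C)), commMat_map]
  simp [Algebra.smul_def]

/-- A matrix commutes with all `ν s` if it satisfies the linear equations. -/
theorem commute_iff {C : Type*} [CommRing C] [Algebra B C] (ν : S → Matrix (Fin n) (Fin n) B)
    (y : Matrix (Fin n) (Fin n) C) :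
    (∀ s, y * (ν s).map (algebraMap B C) = (ν s).map (algebraMap B C) * y) ↔
      ∀ x, ∑ ab, commMat ν x ab • y ab.1 ab.2 = 0 := by
  simp only [sum_commMat_smul]
  constructor
  · intro h x
    rw [h, sub_self]
    rfl
  · intro h s
    ext i j
    exact sub_eq_zero.1 (h (s, i, j))

/-- The module of which the commutant of `ν` is the dual. -/
abbrev CommMod (ν : S → Matrix (Fin n) (Fin n) B) : Type u := rowCoker (commMat ν)

/-- The linear map out of `CommMod ν` given by a solution of the linear equations. -/
noncomputable def CommMod.lift {ν : S → Matrix (Fin n) (Fin n) B} {P : Type*} [AddCommGroup P]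
    [Module B P] (y : Fin n × Fin n → P) (hy : ∀ x, ∑ ab, commMat ν x ab • y ab = 0) :
    CommMod ν →ₗ[B] P :=
  Submodule.liftQ _ (Fintype.linearCombination B y) (by
    rw [Submodule.span_le]
    rintro _ ⟨x, rfl⟩
    exact hy x)

/-- The class of a coordinate. -/
noncomputable def CommMod.coord (ν : S → Matrix (Fin n) (Fin n) B) (ab : Fin n × Fin n) :
    CommMod ν :=
  Submodule.Quotient.mk (Pi.single ab 1)

theorem CommMod.lift_coord {ν : S → Matrix (Fin n) (Fin n) B} {P : Type*} [AddCommGroup P]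
    [Module B P] (y : Fin n × Fin n → P) (hy : ∀ x, ∑ ab, commMat ν x ab • y ab = 0)
    (ab : Fin n × Fin n) : CommMod.lift y hy (CommMod.coord ν ab) = y ab := by
  rw [CommMod.lift, CommMod.coord, Submodule.liftQ_apply, Fintype.linearCombination_apply_single,
    one_smul]

theorem CommMod.hom_ext {ν : S → Matrix (Fin n) (Fin n) B} {P : Type*} [AddCommGroup P]
    [Module B P] {f f' : CommMod ν →ₗ[B] P}
    (h : ∀ ab, f (CommMod.coord ν ab) = f' (CommMod.coord ν ab)) : f = f' := by
  refine Submodule.linearMap_qext _ (LinearMap.pi_ext' fun ab => LinearMap.ext_ring ?_)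
  exact h ab

theorem CommMod.sum_coord (ν : S → Matrix (Fin n) (Fin n) B) (x : S × Fin n × Fin n) :
    ∑ ab, commMat ν x ab • CommMod.coord ν ab = 0 := by
  have h : ∑ ab, commMat ν x ab • CommMod.coord ν ab =
      Submodule.Quotient.mk (∑ ab, commMat ν x ab • Pi.single ab 1) := by
    rw [← Submodule.mkQ_apply, map_sum]
    rfl
  rw [h, Submodule.Quotient.mk_eq_zero]
  rw [← pi_eq_sum_univ' (commMat ν x)]
  exact Submodule.subset_span ⟨x, rfl⟩

/-- The universal matrix commuting with all `ν s`. -/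
noncomputable def commUniv (ν : S → Matrix (Fin n) (Fin n) B) :
    Matrix (Fin n) (Fin n) (SymmetricAlgebra B (CommMod ν)) :=
  Matrix.of fun a b => SymmetricAlgebra.ι B (CommMod ν) (CommMod.coord ν (a, b))

/-- The coordinate ring of the group scheme of invertible matrices commuting with all `ν s`. -/
abbrev AutRing (ν : S → Matrix (Fin n) (Fin n) B) : Type u := Localization.Away (commUniv ν).det

/-- The universal invertible matrix commuting with all `ν s`. -/
noncomputable def autUniv (ν : S → Matrix (Fin n) (Fin n) B) :
    Matrix (Fin n) (Fin n) (AutRing ν) :=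
  (commUniv ν).map (algebraMap (SymmetricAlgebra B (CommMod ν)) (AutRing ν))

theorem commUniv_commute (ν : S → Matrix (Fin n) (Fin n) B) (s : S) :
    commUniv ν * (ν s).map (algebraMap B _) = (ν s).map (algebraMap B _) * commUniv ν := by
  revert s
  rw [commute_iff]
  intro x
  have := congrArg (SymmetricAlgebra.ι B (CommMod ν)) (CommMod.sum_coord ν x)
  simp only [map_sum, map_smul, map_zero] at this
  exact this

theorem autUniv_commute (ν : S → Matrix (Fin n) (Fin n) B) (s : S) :
    autUniv ν * (ν s).map (algebraMap B _) = (ν s).map (algebraMap B _) * autUniv ν := by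
  have h := congrArg (fun X => X.map (algebraMap (SymmetricAlgebra B (CommMod ν)) (AutRing ν)))
    (commUniv_commute ν s)
  simp only [Matrix.map_mul, Matrix.map_map, ← RingHom.coe_comp,
    ← IsScalarTower.algebraMap_eq] at h
  exact h

theorem isUnit_det_autUniv (ν : S → Matrix (Fin n) (Fin n) B) : IsUnit (autUniv ν).det := by
  have h := RingHom.map_det (algebraMap (SymmetricAlgebra B (CommMod ν)) (AutRing ν)) (commUniv ν)
  rw [RingHom.mapMatrix_apply] at h
  rw [autUniv, ← h]
  exact IsLocalization.Away.algebraMap_isUnit _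

/-- The universal property of `AutRing ν`. -/
theorem existsUnique_autRing_hom (ν : S → Matrix (Fin n) (Fin n) B) {C : Type*} [CommRing C]
    [Algebra B C] {y : Matrix (Fin n) (Fin n) C}
    (hy : ∀ s, y * (ν s).map (algebraMap B C) = (ν s).map (algebraMap B C) * y)
    (hu : IsUnit y.det) : ∃! f : AutRing ν →ₐ[B] C, (autUniv ν).map f = y := by
  rw [commute_iff] at hy
  let l := SymmetricAlgebra.lift (CommMod.lift (fun ab => y ab.1 ab.2) hy)
  have hl : (commUniv ν).map l = y := by
    ext a b
    simp [l, commUniv, CommMod.lift_coord]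
  have hdet : l (commUniv ν).det = y.det := by
    rw [← hl, AlgHom.map_det]
    rfl
  have hunit : ∀ z : Submonoid.powers (commUniv ν).det, IsUnit (l z) := by
    rintro ⟨_, m, rfl⟩
    rw [map_pow, hdet]
    exact hu.pow m
  refine ⟨IsLocalization.liftAlgHom (S := AutRing ν) (f := l) hunit, ?_, ?_⟩
  · rw [← hl]
    ext a b
    simp only [autUniv, Matrix.map_apply]
    rw [IsLocalization.coe_liftAlgHom, IsLocalization.lift_eq]
    rfl
  · intro f hf
    refine IsLocalization.algHom_ext (Submonoid.powers (commUniv ν).det) ?_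
    refine SymmetricAlgebra.algHom_ext (CommMod.hom_ext fun ab => ?_)
    have h1 : f (algebraMap _ _ (SymmetricAlgebra.ι B (CommMod ν) (CommMod.coord ν ab))) =
      y ab.1 ab.2 := congrFun (congrFun hf ab.1) ab.2
    have h2 : l (SymmetricAlgebra.ι B (CommMod ν) (CommMod.coord ν ab)) = y ab.1 ab.2 :=
      congrFun (congrFun hl ab.1) ab.2
    refine h1.trans (h2.symm.trans ?_)
    change _ = IsLocalization.liftAlgHom (S := AutRing ν) (f := l) hunit (algebraMap _ _ _)
    rw [IsLocalization.coe_liftAlgHom, IsLocalization.lift_eq]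
    rfl

/-- The first order deformations of the identity. -/
theorem flat_commMod_of_flat_autRing (ν : S → Matrix (Fin n) (Fin n) B)
    [Module.Flat B (AutRing ν)] : Module.Flat B (CommMod ν) := by
  -- Over the square zero extension of `B` by `CommMod ν`, the matrix `1 + z` with `z` made of the
  -- universal coordinates is an invertible element of the commutant. The second component of its
  -- classifying map retracts the linear inclusion of `CommMod ν` into the coordinate ring.
  let D := TrivSqZeroExt B (CommMod ν)
  let z : Matrix (Fin n) (Fin n) D := Matrix.of fun a b => TrivSqZeroExt.inr (CommMod.coord ν (a, b))
  have hz : ∀ s, z * (ν s).map (algebraMap B D) = (ν s).map (algebraMap B D) * z := by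
    rw [commute_iff]
    intro x
    have := congrArg (TrivSqZeroExt.inrHom B (CommMod ν)) (CommMod.sum_coord ν x)
    simp only [map_sum, map_smul, map_zero] at this
    exact this
  have hzz : z * z = 0 := by
    ext1 a b
    rw [Matrix.mul_apply]
    exact Finset.sum_eq_zero fun c _ => TrivSqZeroExt.inr_mul_inr _ _ _
  have hy : ∀ s, (1 + z) * (ν s).map (algebraMap B D) = (ν s).map (algebraMap B D) * (1 + z) :=
    fun s => by rw [add_mul, mul_add, hz, one_mul, mul_one]
  have hu : IsUnit (1 + z).det := by
    rw [← Matrix.isUnit_iff_isUnit_det]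
    exact IsUnit.of_mul_eq_one (1 - z) (by simp [add_mul, mul_sub, hzz])
  obtain ⟨f, hf, -⟩ := existsUnique_autRing_hom ν hy hu
  let i : CommMod ν →ₗ[B] AutRing ν := CommMod.lift (fun ab => autUniv ν ab.1 ab.2)
    ((commute_iff ν _).1 (autUniv_commute ν))
  refine Module.Flat.of_retract i (TrivSqZeroExt.sndHom B (CommMod ν) ∘ₗ f.toLinearMap)
    (CommMod.hom_ext fun ab => ?_)
  have h1 : f (autUniv ν ab.1 ab.2) = (1 + z) ab.1 ab.2 := congrFun (congrFun hf ab.1) ab.2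
  simp only [LinearMap.comp_apply, i, CommMod.lift_coord, LinearMap.id_apply,
    AlgHom.toLinearMap_apply, h1, Matrix.add_apply]
  have h2 : (TrivSqZeroExt.sndHom B (CommMod ν)) ((1 : Matrix (Fin n) (Fin n) D) ab.1 ab.2) = 0 := by
    rw [Matrix.one_apply]
    split_ifs <;> simp
  rw [map_add, h2, zero_add]
  rfl

/-- One direction is the retraction onto `CommMod ν`. For the other, the symmetric algebra of a
projective module is flat, and localizing at the determinant preserves flatness. -/
theorem flat_autRing_iff [Fintype S] (ν : S → Matrix (Fin n) (Fin n) B) :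
    Module.Flat B (AutRing ν) ↔
      ∃ U : Matrix (Fin n × Fin n) (S × Fin n × Fin n) B, commMat ν * U * commMat ν = commMat ν := by
  rw [← projective_rowCoker_iff]
  constructor
  · intro h
    have := flat_commMod_of_flat_autRing ν
    rwa [projective_rowCoker_iff, ← flat_rowCoker_iff]
  · intro h
    have : Module.Flat B (SymmetricAlgebra B (CommMod ν)) := flat_symmetricAlgebra
    have : Module.Flat (SymmetricAlgebra B (CommMod ν)) (AutRing ν) :=
      IsLocalization.flat _ (Submonoid.powers (commUniv ν).det)
    exact Module.Flat.trans B (SymmetricAlgebra B (CommMod ν)) (AutRing ν)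

/-- A basis identifies the symmetric algebra with a polynomial ring, and the identity matrix is a
rational point where the inverted determinant equals 1. -/
theorem ringKrullDim_autRing {K : Type u} [Field K] (ν : S → Matrix (Fin n) (Fin n) K) :
    ringKrullDim (AutRing ν) = Module.finrank K (CommMod ν) := by
  let b := Module.finBasis K (CommMod ν)
  let e := SymmetricAlgebra.equivMvPolynomial b
  set f := e (commUniv ν).det
  have h1 : Submonoid.map e.toRingEquiv.toMonoidHom (Submonoid.powers (commUniv ν).det) =
      Submonoid.powers f := by
    rw [Submonoid.map_powers]
    rfl
  rw [ringKrullDim_eq_of_ringEquiv (IsLocalization.ringEquivOfRingEquiv (AutRing ν)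
    (Localization.Away f) e.toRingEquiv h1)]
  have hone : ∀ s, (1 : Matrix (Fin n) (Fin n) K) * (ν s).map (algebraMap K K) =
      (ν s).map (algebraMap K K) * 1 := fun s => by rw [mul_one, one_mul]
  let l := SymmetricAlgebra.lift (CommMod.lift (ν := ν) (fun ab => (1 : Matrix _ _ K) ab.1 ab.2)
    ((commute_iff ν _).1 hone))
  have hl : (commUniv ν).map l = 1 := by
    ext a b
    simp [l, commUniv, CommMod.lift_coord]
  have hdet : l (commUniv ν).det = 1 := by
    have := AlgHom.map_det l (commUniv ν)
    rw [this, show l.mapMatrix (commUniv ν) = 1 from hl, Matrix.det_one]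
  let g : MvPolynomial _ K →ₐ[K] K := l.comp e.symm.toAlgHom
  have hg : MvPolynomial.eval (fun j => g (MvPolynomial.X j)) f ≠ 0 := by
    have h2 : MvPolynomial.aeval (fun j => g (MvPolynomial.X j)) = g :=
      (MvPolynomial.aeval_unique g).symm
    have h3 := DFunLike.congr_fun h2 f
    rw [MvPolynomial.aeval_eq_eval] at h3
    rw [h3]
    have : g f = l (commUniv ν).det := congrArg l (e.symm_apply_apply _)
    rw [this, hdet]
    exact one_ne_zero
  exact ringKrullDim_away_mvPolynomial hg (Localization.Away f)

end Commutant
end NilpRep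

namespace NilpRep

/-! ### The automorphism scheme of a representation by matrices -/

section AutRing

variable {k : Type u} [Field k] {g : Type v} [LieRing g] [LieAlgebra k g]

/-- Uniqueness of a representing object: each universal automorphism is classified by a map to the
other ring, and the two composites fix the universal ones. Flatness and dimension may thus be tested
on any model. -/
theorem IsAutRing.algEquiv {A : Type u} [CommRing A] [Algebra k A]
    {E : Type u} [AddCommGroup E] [Module A E] [Module k E] [IsScalarTower k A E]
    {ρ : g →ₗ⁅k⁆ Module.End A E} {R R' : Type u} [CommRing R] [Algebra A R] [CommRing R']
    [Algebra A R'] (h : IsAutRing ρ R) (h' : IsAutRing ρ R') : Nonempty (R ≃ₐ[A] R') := by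
  obtain ⟨φ, hφ⟩ := h
  obtain ⟨φ', hφ'⟩ := h'
  obtain ⟨f, hf, -⟩ := hφ R' φ'
  obtain ⟨f', hf', -⟩ := hφ' R φ
  have h1 : f'.comp f = AlgHom.id A R := by
    refine (hφ R φ).unique (fun x => ?_) fun x => by
      simp only [AlgHom.toLinearMap_id, LinearMap.rTensor_id, LinearMap.id_apply]
    rw [AlgHom.comp_toLinearMap, LinearMap.rTensor_comp_apply, hf', hf,
      LinearMap.rTensor_comp_apply]
  have h2 : f.comp f' = AlgHom.id A R' := by
    refine (hφ' R' φ').unique (fun x => ?_) fun x => by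
      simp only [AlgHom.toLinearMap_id, LinearMap.rTensor_id, LinearMap.id_apply]
    rw [AlgHom.comp_toLinearMap, LinearMap.rTensor_comp_apply, hf, hf',
      LinearMap.rTensor_comp_apply]
  exact ⟨AlgEquiv.ofAlgHom f f' h2 h1⟩

/-- The base change of a standard free module. -/
noncomputable def baseEquiv (B C : Type u) [CommRing B] [CommRing C] [Algebra B C] (n : ℕ) :
    C ⊗[B] (Fin n → B) ≃ₗ[C] (Fin n → C) :=
  TensorProduct.piScalarRight B C C (Fin n)

theorem baseEquiv_tmul (B C : Type u) [CommRing B] [CommRing C] [Algebra B C] (n : ℕ) (c : C)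
    (x : Fin n → B) (j : Fin n) : baseEquiv B C n (c ⊗ₜ x) j = x j • c := rfl

variable {n : ℕ} {B : Type u} [CommRing B] [Algebra k B]

theorem toRep_apply (r : HomPts k g n B) (v : g) (x : Fin n → B) :
    r.toRep v x = (r v).1.mulVec x := rfl

theorem baseEquiv_baseChange (r : HomPts k g n B) (C : Type u) [CommRing C] [Algebra B C]
    (v : g) (x : C ⊗[B] (Fin n → B)) :
    baseEquiv B C n ((r.toRep v).baseChange C x) =
      ((r v).1.map (algebraMap B C)).mulVec (baseEquiv B C n x) := by
  induction x using TensorProduct.induction_on with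
  | zero => simp
  | add x y hx hy => simp only [map_add, hx, hy, Matrix.mulVec_add]
  | tmul c x =>
    ext i
    simp only [LinearMap.baseChange_tmul, baseEquiv_tmul, toRep_apply, Matrix.mulVec, dotProduct,
      Finset.sum_smul, Matrix.map_apply]
    refine Finset.sum_congr rfl fun j _ => ?_
    rw [mul_smul, Algebra.smul_def]

theorem baseEquiv_rTensor {C C' : Type u} [CommRing C] [Algebra B C] [CommRing C']
    [Algebra B C'] (f : C →ₐ[B] C') (x : C ⊗[B] (Fin n → B)) :
    baseEquiv B C' n (f.toLinearMap.rTensor _ x) =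
      f ∘ baseEquiv B C n x := by
  induction x using TensorProduct.induction_on with
  | zero => ext; simp
  | add x y hx hy => ext j; simp [hx, hy]
  | tmul c x => ext j; simp [baseEquiv_tmul]

/-- The matrix of an automorphism. -/
noncomputable def RepAut.toMat {r : HomPts k g n B} {C : Type u} [CommRing C] [Algebra B C]
    (ψ : RepAut r.toRep C) : Matrix (Fin n) (Fin n) C :=
  LinearMap.toMatrix' ((baseEquiv B C n).toLinearMap ∘ₗ ψ.1.toLinearMap ∘ₗ
    (baseEquiv B C n).symm.toLinearMap)

theorem RepAut.toMat_mulVec {r : HomPts k g n B} {C : Type u} [CommRing C] [Algebra B C]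
    (ψ : RepAut r.toRep C) (x : C ⊗[B] (Fin n → B)) :
    ψ.toMat.mulVec (baseEquiv B C n x) =
      baseEquiv B C n (ψ.1 x) := by
  rw [RepAut.toMat, LinearMap.toMatrix'_mulVec]
  simp

theorem mulVec_ext {C : Type u} [CommRing C] [Algebra B C]
    {y z : Matrix (Fin n) (Fin n) C} (h : ∀ x : C ⊗[B] (Fin n → B),
      y.mulVec (baseEquiv B C n x) =
        z.mulVec (baseEquiv B C n x)) : y = z := by
  refine Matrix.ext_of_mulVec_single fun i => ?_
  have := h ((baseEquiv B C n).symm (Pi.single i 1))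
  rwa [LinearEquiv.apply_symm_apply] at this

theorem RepAut.toMat_commute {r : HomPts k g n B} {C : Type u} [CommRing C] [Algebra B C]
    (ψ : RepAut r.toRep C) (v : g) :
    ψ.toMat * (r v).1.map (algebraMap B C) = (r v).1.map (algebraMap B C) * ψ.toMat := by
  refine mulVec_ext (B := B) fun x => ?_
  rw [← Matrix.mulVec_mulVec, ← Matrix.mulVec_mulVec, RepAut.toMat_mulVec,
    ← baseEquiv_baseChange, ← baseEquiv_baseChange, RepAut.toMat_mulVec, ψ.2]

theorem RepAut.isUnit_det_toMat {r : HomPts k g n B} {C : Type u} [CommRing C] [Algebra B C]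
    (ψ : RepAut r.toRep C) : IsUnit ψ.toMat.det := by
  rw [← Matrix.isUnit_iff_isUnit_det]
  refine IsUnit.of_mul_eq_one (LinearMap.toMatrix'
    ((baseEquiv B C n).toLinearMap ∘ₗ ψ.1.symm.toLinearMap ∘ₗ
      (baseEquiv B C n).symm.toLinearMap)) ?_
  rw [RepAut.toMat, ← LinearMap.toMatrix'_comp]
  convert LinearMap.toMatrix'_id
  ext x
  simp

/-- The automorphism given by an invertible matrix. -/
noncomputable def RepAut.ofMat (r : HomPts k g n B) {C : Type u} [CommRing C] [Algebra B C]
    (y : Matrix (Fin n) (Fin n) C) (hu : IsUnit y.det)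
    (hy : ∀ v, y * (r v).1.map (algebraMap B C) = (r v).1.map (algebraMap B C) * y) :
    RepAut r.toRep C :=
  ⟨(baseEquiv B C n).trans
    ((Matrix.toLin'OfInv (Matrix.nonsing_inv_mul y hu) (Matrix.mul_nonsing_inv y hu)).trans
      (baseEquiv B C n).symm), fun v x => by
    apply (baseEquiv B C n).injective
    rw [baseEquiv_baseChange]
    simp only [LinearEquiv.trans_apply, LinearEquiv.apply_symm_apply, baseEquiv_baseChange]
    change y.mulVec _ = Matrix.mulVec _ (y.mulVec _)
    rw [Matrix.mulVec_mulVec, Matrix.mulVec_mulVec, hy]⟩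

theorem RepAut.toMat_ofMat (r : HomPts k g n B) {C : Type u} [CommRing C] [Algebra B C]
    (y : Matrix (Fin n) (Fin n) C) (hu : IsUnit y.det)
    (hy : ∀ v, y * (r v).1.map (algebraMap B C) = (r v).1.map (algebraMap B C) * y) :
    (RepAut.ofMat r y hu hy).toMat = y := by
  refine mulVec_ext (B := B) fun x => ?_
  rw [RepAut.toMat_mulVec]
  exact (baseEquiv B C n).apply_symm_apply _

/-- The matrices representing a family of elements of `g`. -/
def HomPts.mats {S : Type*} (r : HomPts k g n B) (s : S → g) (i : S) : Matrix (Fin n) (Fin n) B :=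
  (r (s i)).1

/-- The elements whose matrices commute with `y` form a Lie subalgebra. Hence finitely many
equations suffice when the generating family is finite. -/
theorem commute_of_generators {S : Type*} {s : S → g}
    (hs : LieSubalgebra.lieSpan k g (Set.range s) = ⊤) (r : HomPts k g n B) {C : Type u}
    [CommRing C] [Algebra B C] {y : Matrix (Fin n) (Fin n) C}
    (hy : ∀ i, y * (r.mats s i).map (algebraMap B C) = (r.mats s i).map (algebraMap B C) * y)
    (v : g) : y * (r v).1.map (algebraMap B C) = (r v).1.map (algebraMap B C) * y := by
  let L : LieSubalgebra k g :=
    { carrier := {v | y * (r v).1.map (algebraMap B C) = (r v).1.map (algebraMap B C) * y}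
      add_mem' := fun {v w} hv hw => by
        have : (r (v + w)).1.map (algebraMap B C) =
            (r v).1.map (algebraMap B C) + (r w).1.map (algebraMap B C) := by
          ext; simp
        simp only [Set.mem_ofPred_eq, this] at hv hw ⊢
        rw [mul_add, add_mul, hv, hw]
      zero_mem' := by
        have : (r 0).1.map (algebraMap B C) = 0 := by ext; simp
        simp only [Set.mem_ofPred_eq, this, mul_zero, zero_mul]
      smul_mem' := fun c v hv => by
        have : (r (c • v)).1.map (algebraMap B C) =
            algebraMap B C (algebraMap k B c) • (r v).1.map (algebraMap B C) := by
          ext i j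
          rw [map_smul, Matrix.map_apply, Matrix.smul_apply, smul_eq_mul, Matrix.map_apply,
            ← map_mul, ← Algebra.smul_def]
          rfl
        simp only [Set.mem_ofPred_eq, this] at hv ⊢
        rw [Matrix.mul_smul, hv, Matrix.smul_mul]
      lie_mem' := fun {v w} hv hw => by
        simp only [Set.mem_ofPred_eq] at hv hw ⊢
        have : (r ⁅v, w⁆).1.map (algebraMap B C) =
            (r v).1.map (algebraMap B C) * (r w).1.map (algebraMap B C) -
              (r w).1.map (algebraMap B C) * (r v).1.map (algebraMap B C) := by
          rw [← Matrix.map_mul, ← Matrix.map_mul, ← Matrix.map_sub _ (map_sub _), LieHom.map_lie,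
            LieSubalgebra.coe_bracket, LieRing.of_associative_ring_bracket]
        rw [this, mul_sub, sub_mul, ← mul_assoc, ← mul_assoc, hv, hw, mul_assoc, mul_assoc, hv, hw,
          mul_assoc, mul_assoc] }
  have : L = ⊤ := by
    rw [← top_le_iff, ← hs, LieSubalgebra.lieSpan_le]
    rintro _ ⟨i, rfl⟩
    exact hy i
  exact (this ▸ LieSubalgebra.mem_top v : v ∈ L)

variable {S : Type*} {s : S → g}

/-- In the standard basis an automorphism is an invertible matrix in the commutant, and base change
along `f` applies `f` to the entries, so the universal property of `AutRing` is the required one. -/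
theorem isAutRing_autRing (hs : LieSubalgebra.lieSpan k g (Set.range s) = ⊤) (r : HomPts k g n B) :
    IsAutRing r.toRep (AutRing (r.mats s)) := by
  refine ⟨RepAut.ofMat r (autUniv (r.mats s)) (isUnit_det_autUniv _)
    (commute_of_generators hs r (autUniv_commute _)), fun C _ _ ψ => ?_⟩
  have key : ∀ f : AutRing (r.mats s) →ₐ[B] C,
      (∀ x, ψ.1 (f.toLinearMap.rTensor _ x) = f.toLinearMap.rTensor _ ((RepAut.ofMat r
        (autUniv (r.mats s)) (isUnit_det_autUniv _)
        (commute_of_generators hs r (autUniv_commute _))).1 x)) ↔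
      (autUniv (r.mats s)).map f = ψ.toMat := by
    intro f
    set φ := RepAut.ofMat r (autUniv (r.mats s)) (isUnit_det_autUniv _)
        (commute_of_generators hs r (autUniv_commute _)) with hφ
    have h1 : ∀ x, baseEquiv B C n (ψ.1 (f.toLinearMap.rTensor _ x)) =
        ψ.toMat.mulVec (f ∘ baseEquiv B _ n x) := fun x => by
      rw [← RepAut.toMat_mulVec, baseEquiv_rTensor]
    have h2 : ∀ x, baseEquiv B C n (f.toLinearMap.rTensor _ (φ.1 x)) =
        ((autUniv (r.mats s)).map f).mulVec (f ∘ baseEquiv B _ n x) :=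
      fun x => by
      rw [baseEquiv_rTensor, ← RepAut.toMat_mulVec, hφ, RepAut.toMat_ofMat]
      funext i
      exact RingHom.map_mulVec f.toRingHom _ _ _
    constructor
    · intro h
      refine Matrix.ext_of_mulVec_single fun i => ?_
      have h3 := h1 ((baseEquiv B _ n).symm (Pi.single i 1))
      rw [h, h2, LinearEquiv.apply_symm_apply] at h3
      have h4 : f ∘ (Pi.single i 1 : Fin n → AutRing (r.mats s)) = Pi.single i 1 := by
        funext j
        simp only [Function.comp_apply, Pi.single_apply]
        split_ifs <;> simp
      rwa [h4] at h3
    · intro h x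
      apply (baseEquiv B C n).injective
      rw [h1, h2, h]
  simp only [key]
  exact existsUnique_autRing_hom _ (fun i => ψ.toMat_commute (s i)) ψ.isUnit_det_toMat

/-- The group scheme of automorphisms is flat if and only if the matrix of the linear equations
for it is von Neumann regular. -/
theorem autFlat_iff [Fintype S] (hs : LieSubalgebra.lieSpan k g (Set.range s) = ⊤)
    (r : HomPts k g n B) : AutFlat r.toRep ↔
      ∃ U : Matrix (Fin n × Fin n) (S × Fin n × Fin n) B,
        commMat (r.mats s) * U * commMat (r.mats s) = commMat (r.mats s) := by
  rw [← flat_autRing_iff]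
  constructor
  · rintro ⟨R, _, _, hR, hflat⟩
    obtain ⟨e⟩ := hR.algEquiv (isAutRing_autRing hs r)
    exact Module.Flat.of_linearEquiv e.symm.toLinearEquiv
  · intro h
    exact ⟨_, _, _, isAutRing_autRing hs r, h⟩

/-- Over a field, the dimension of the group scheme of automorphisms is that of the commutant. -/
theorem hasAutDim_iff {K : Type u} [Field K] [Algebra k K]
    (hs : LieSubalgebra.lieSpan k g (Set.range s) = ⊤) (r : HomPts k g n K) (d : WithBot ℕ∞) :
    HasAutDim r.toRep d ↔ d = Module.finrank K (CommMod (r.mats s)) := by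
  rw [← ringKrullDim_autRing]
  constructor
  · rintro ⟨R, _, _, hR, hd⟩
    obtain ⟨e⟩ := hR.algEquiv (isAutRing_autRing hs r)
    rw [← hd, ringKrullDim_eq_of_ringEquiv e.toRingEquiv]
  · rintro rfl
    exact ⟨_, _, _, isAutRing_autRing hs r, rfl⟩

end AutRing
end NilpRep

namespace NilpRep

/-! ### Invariance under isomorphism of representations -/

section Transport

variable {k : Type u} [Field k] {g : Type v} [LieRing g] [LieAlgebra k g]
variable {A : Type u} [CommRing A] [Algebra k A]
variable {E E' : Type u} [AddCommGroup E] [Module A E] [Module k E] [IsScalarTower k A E]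
  [AddCommGroup E'] [Module A E'] [Module k E'] [IsScalarTower k A E']

/-- The linear equivalence `e` is an isomorphism of representations. -/
def Intertwines (ρ : g →ₗ⁅k⁆ Module.End A E) (ρ' : g →ₗ⁅k⁆ Module.End A E') (e : E ≃ₗ[A] E') :
    Prop :=
  ∀ v x, e (ρ v x) = ρ' v (e x)

variable {ρ : g →ₗ⁅k⁆ Module.End A E} {ρ' : g →ₗ⁅k⁆ Module.End A E'} {e : E ≃ₗ[A] E'}

namespace Intertwines

theorem symm (h : Intertwines ρ ρ' e) : Intertwines ρ' ρ e.symm := fun v x => by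
  rw [LinearEquiv.symm_apply_eq, h, LinearEquiv.apply_symm_apply]

theorem mem_fil (h : Intertwines ρ ρ' e) (i : ℕ) (x : E) : e x ∈ fil ρ' i ↔ x ∈ fil ρ i := by
  induction i generalizing x with
  | zero => simp [fil]
  | succ i ih => simp only [mem_fil_succ, ← h _ x, ih]

theorem map_fil (h : Intertwines ρ ρ' e) (i : ℕ) :
    (fil ρ i).map (e : E →ₗ[A] E') = fil ρ' i := by
  ext x
  rw [Submodule.mem_map_equiv, ← h.mem_fil, LinearEquiv.apply_symm_apply]

theorem filSub (h : Intertwines ρ ρ' e) (i : ℕ) :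
    Intertwines (filSub ρ i) (filSub ρ' i) (e.ofSubmodules _ _ (h.map_fil i)) := fun v x =>
  Subtype.ext (h v x)

theorem filQuot (h : Intertwines ρ ρ' e) (i : ℕ) :
    Intertwines (filQuot ρ i) (filQuot ρ' i) (Submodule.Quotient.equiv _ _ e (h.map_fil i)) := by
  intro v x
  obtain ⟨x, rfl⟩ := Submodule.mkQ_surjective _ x
  exact congrArg (Submodule.mkQ _) (h v x)

theorem baseChange_apply (h : Intertwines ρ ρ' e) (B : Type u) [CommRing B] [Algebra A B] (v : g)
    (x : B ⊗[A] E) : e.baseChange A B E E' ((ρ v).baseChange B x) =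
      (ρ' v).baseChange B (e.baseChange A B E E' x) := by
  induction x using TensorProduct.induction_on with
  | zero => simp
  | add x y hx hy => simp only [map_add, hx, hy]
  | tmul b x =>
    change b ⊗ₜ e (ρ v x) = b ⊗ₜ[A] ρ' v (e x)
    rw [h]

theorem baseChange (h : Intertwines ρ ρ' e) (B : Type u) [CommRing B] [Algebra k B] [Algebra A B]
    [IsScalarTower k A B] :
    Intertwines (baseChangeRep ρ B) (baseChangeRep ρ' B) (e.baseChange A B E E') :=
  h.baseChange_apply B

theorem isFlag {n : ℕ} (h : Intertwines ρ ρ' e) (hρ : IsFlag n ρ) : IsFlag n ρ' := by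
  obtain ⟨⟨h1, h2, h3⟩, h4, h5⟩ := hρ
  refine ⟨⟨Module.Finite.equiv e, Module.Projective.of_equiv e, fun p => ?_⟩, fun i => ?_, ?_⟩
  · rw [← Module.rankAtStalk_eq_of_equiv e, h3]
  · obtain ⟨h6, h7, h8⟩ := h4 i
    let e' := Submodule.Quotient.equiv _ _ e (h.map_fil i)
    refine ⟨Module.Finite.equiv e', Module.Projective.of_equiv e', fun p => ?_⟩
    rw [← Module.rankAtStalk_eq_of_equiv e', h8]
  · intro B _ _ _ _ i
    rw [← (h.baseChange B).map_fil i, h5, ← h.map_fil i, Submodule.baseChange_eq_span,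
      Submodule.baseChange_eq_span, Submodule.map_span]
    congr 1
    ext x
    simp only [Set.mem_image, SetLike.mem_coe, Submodule.mem_map]
    constructor
    · rintro ⟨_, ⟨y, hy, rfl⟩, rfl⟩
      exact ⟨e y, ⟨y, hy, rfl⟩, rfl⟩
    · rintro ⟨_, ⟨y, hy, rfl⟩, rfl⟩
      exact ⟨_, ⟨y, hy, rfl⟩, rfl⟩

/-- Conjugation of automorphisms by an isomorphism of representations. -/
noncomputable def repAut (h : Intertwines ρ ρ' e) (B : Type u) [CommRing B] [Algebra A B]
    (φ : RepAut ρ B) : RepAut ρ' B :=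
  ⟨(e.baseChange A B E E').symm.trans (φ.1.trans (e.baseChange A B E E')), fun v x => by
    obtain ⟨x, rfl⟩ := (e.baseChange A B E E').surjective x
    simp only [LinearEquiv.trans_apply, ← h.baseChange_apply, LinearEquiv.symm_apply_apply, φ.2]⟩

theorem repAut_apply (h : Intertwines ρ ρ' e) (B : Type u) [CommRing B] [Algebra A B]
    (φ : RepAut ρ B) (x : B ⊗[A] E) : (h.repAut B φ).1 (e.baseChange A B E E' x) =
      e.baseChange A B E E' (φ.1 x) := by
  simp [repAut]

/-- Conjugation by `e` is a bijection between the automorphism functors, natural in the algebra, so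
the same ring represents both. -/
theorem isAutRing (h : Intertwines ρ ρ' e) {R : Type u} [CommRing R] [Algebra A R]
    (hR : IsAutRing ρ R) : IsAutRing ρ' R := by
  obtain ⟨φ, hφ⟩ := hR
  refine ⟨h.repAut R φ, fun B _ _ ψ => ?_⟩
  have hnat : ∀ (f : R →ₐ[A] B) (x : R ⊗[A] E),
      f.toLinearMap.rTensor E' (e.baseChange A R E E' x) =
        e.baseChange A B E E' (f.toLinearMap.rTensor E x) := by
    intro f x
    induction x using TensorProduct.induction_on with
    | zero => simp
    | add x y hx hy => simp only [map_add, hx, hy]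
    | tmul b x => rfl
  obtain ⟨f, hf, huniq⟩ := hφ B (h.symm.repAut B ψ)
  have hψ : ∀ x, ψ.1 (e.baseChange A B E E' x) =
      e.baseChange A B E E' ((h.symm.repAut B ψ).1 x) := fun x => by
    have h1 := h.symm.repAut_apply B ψ (e.baseChange A B E E' x)
    have h2 : ∀ y, e.symm.baseChange A B E' E (e.baseChange A B E E' y) = y := fun y =>
      (e.baseChange A B E E').symm_apply_apply y
    have h3 : ∀ y, e.baseChange A B E E' (e.symm.baseChange A B E' E y) = y := fun y =>
      (e.baseChange A B E E').apply_symm_apply y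
    rw [h2] at h1
    rw [h1, h3]
  have key : ∀ f : R →ₐ[A] B,
      (∀ x, ψ.1 (f.toLinearMap.rTensor E' x) = f.toLinearMap.rTensor E' ((h.repAut R φ).1 x)) ↔
      ∀ x, (h.symm.repAut B ψ).1 (f.toLinearMap.rTensor E x) =
        f.toLinearMap.rTensor E (φ.1 x) := by
    intro f
    rw [(e.baseChange A R E E').surjective.forall]
    simp only [hnat, repAut_apply, hψ, EmbeddingLike.apply_eq_iff_eq]
  simp only [key]
  exact ⟨f, hf, huniq⟩

theorem autFlat (h : Intertwines ρ ρ' e) (hρ : AutFlat ρ) : AutFlat ρ' := by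
  obtain ⟨R, _, _, hR, hflat⟩ := hρ
  exact ⟨R, _, _, h.isAutRing hR, hflat⟩

theorem hasAutDim (h : Intertwines ρ ρ' e) {d : WithBot ℕ∞} (hρ : HasAutDim ρ d) :
    HasAutDim ρ' d := by
  obtain ⟨R, _, _, hR, hdim⟩ := hρ
  exact ⟨R, _, _, h.isAutRing hR, hdim⟩

end Intertwines

section Field

variable {K V V' : Type u} [Field K] [Algebra k K] [AddCommGroup V] [Module K V] [Module k V]
  [IsScalarTower k K V] [AddCommGroup V'] [Module K V'] [Module k V'] [IsScalarTower k K V']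
  {ρ : g →ₗ⁅k⁆ Module.End K V} {ρ' : g →ₗ⁅k⁆ Module.End K V'} {e : V ≃ₗ[K] V'}

theorem Intertwines.isFlagOverField {n : ℕ} (h : Intertwines ρ ρ' e) (hρ : IsFlagOverField n ρ) :
    IsFlagOverField n ρ' := by
  obtain ⟨h1, h2, h3⟩ := hρ
  refine ⟨Module.Finite.equiv e, e.finrank_eq ▸ h2, fun i hi => ?_⟩
  rw [← (e.ofSubmodules _ _ (h.map_fil i)).finrank_eq, h3 i hi]

end Field

/-- Apart from the number `d`, the minimality clause does not involve the representation at hand, so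
only the flag, the two smaller representations and the dimension of Aut have to be transported. -/
theorem Intertwines.isNondegOverField {n : ℕ} {K V V' : Type u} [Field K] [Algebra k K]
    [AddCommGroup V] [Module K V] [Module k V] [IsScalarTower k K V] [AddCommGroup V']
    [Module K V'] [Module k V'] [IsScalarTower k K V'] {ρ : g →ₗ⁅k⁆ Module.End K V}
    {ρ' : g →ₗ⁅k⁆ Module.End K V'} {e : V ≃ₗ[K] V'} (h : Intertwines ρ ρ' e)
    (hρ : IsNondegOverField k g n K V ρ) : IsNondegOverField k g n K V' ρ' := by
  match n with
  | 0 => exact h.isFlagOverField hρ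
  | 1 =>
    refine ⟨h.isFlagOverField hρ.1, LieHom.ext fun v => LinearMap.ext fun x => ?_⟩
    have h1 := h v (e.symm x)
    rw [hρ.2, e.apply_symm_apply] at h1
    rw [← h1]
    simp
  | n + 2 =>
    obtain ⟨⟨h1, h2, h3⟩, d, hd, hmin⟩ := hρ
    exact ⟨⟨h.isFlagOverField h1, (h.filSub (n + 1)).isNondegOverField h2,
      (h.filQuot 1).isNondegOverField h3⟩, d, h.hasAutDim hd, hmin⟩

theorem Intertwines.isNondeg {n : ℕ} {A E E' : Type u} [CommRing A] [Algebra k A]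
    [AddCommGroup E] [Module A E] [Module k E] [IsScalarTower k A E]
    [AddCommGroup E'] [Module A E'] [Module k E'] [IsScalarTower k A E']
    {ρ : g →ₗ⁅k⁆ Module.End A E} {ρ' : g →ₗ⁅k⁆ Module.End A E'} {e : E ≃ₗ[A] E'}
    (h : Intertwines ρ ρ' e)
    (hρ : IsNondeg k g n A E ρ) : IsNondeg k g n A E' ρ' := by
  match n with
  | 0 => exact ⟨h.isFlag hρ.1, fun p => (h.baseChange _).isNondegOverField (hρ.2.1 p),
      h.autFlat hρ.2.2⟩
  | n + 1 =>
    obtain ⟨h1, ⟨h2, h3⟩, h4, h5⟩ := hρ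
    exact ⟨h.isFlag h1, ⟨(h.filSub n).isNondeg h2, (h.filQuot 1).isNondeg h3⟩,
      fun p => (h.baseChange _).isNondegOverField (h4 p), h.autFlat h5⟩

end Transport
end NilpRep

namespace NilpRep

/-! ### The flag condition in terms of minors -/

section Flags

variable {k : Type u} [Field k] {g : Type v} [LieRing g] [LieAlgebra k g] {n : ℕ}
variable {B : Type u} [CommRing B] [Algebra k B]

/-- The span of the first `i` standard basis vectors. -/
def lo (B : Type u) [CommRing B] (n i : ℕ) : Submodule B (Fin n → B) where
  carrier := {x | ∀ j : Fin n, i ≤ j → x j = 0}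
  add_mem' {x y} hx hy j hj := by simp [hx j hj, hy j hj]
  zero_mem' j _ := rfl
  smul_mem' c x hx j hj := by simp [hx j hj]

theorem mem_lo {i : ℕ} {x : Fin n → B} : x ∈ lo B n i ↔ ∀ j : Fin n, i ≤ j → x j = 0 := Iff.rfl

theorem lo_eq_top {i : ℕ} (hi : n ≤ i) : lo B n i = ⊤ :=
  eq_top_iff.2 fun _ _ j hj => absurd (hi.trans hj) (not_le.2 j.2)

/-- The quotient by the span of the first `i` standard basis vectors is free. -/
noncomputable def quotLoEquiv (B : Type u) [CommRing B] (n i : ℕ) :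
    ((Fin n → B) ⧸ lo B n i) ≃ₗ[B] ({j : Fin n // i ≤ j} → B) :=
  (Submodule.quotEquivOfEq _ _ (by
    ext x
    rw [mem_lo, LinearMap.mem_ker, funext_iff, Subtype.forall]
    rfl)).trans (LinearMap.quotKerEquivOfSurjective
      (LinearMap.funLeft B B (Subtype.val : {j : Fin n // i ≤ j} → Fin n))
      (LinearMap.funLeft_surjective_of_injective _ _ _ Subtype.val_injective))

theorem card_subtype_le (n i : ℕ) : Fintype.card {j : Fin n // i ≤ j} = n - i := by
  have h := Fintype.card_subtype_compl fun j : Fin n => (j : ℕ) < i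
  have h' : Fintype.card {j : Fin n // (j : ℕ) < i} = min n i := by
    rw [Fintype.card_subtype, Fin.card_filter_val_lt]
  simp only [not_lt] at h
  rw [h, h', Fintype.card_fin]
  omega

theorem finrank_quot_lo (B : Type u) [CommRing B] [Nontrivial B] (n i : ℕ) :
    Module.finrank B ((Fin n → B) ⧸ lo B n i) = n - i := by
  rw [(quotLoEquiv B n i).finrank_eq, Module.finrank_pi, card_subtype_le]

theorem finrank_lo (K : Type u) [Field K] {n i : ℕ} (hi : i ≤ n) :
    Module.finrank K (lo K n i) = i := by
  have h := Submodule.finrank_quotient_add_finrank (lo K n i)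
  rw [finrank_quot_lo, Module.finrank_pi, Fintype.card_fin] at h
  omega

/-- The filtration contains the standard flag. -/
theorem lo_le_fil (r : HomPts k g n B) (i : ℕ) : lo B n i ≤ fil r.toRep i := by
  induction i with
  | zero =>
    intro x hx
    rw [show x = 0 from funext fun j => hx j (Nat.zero_le _)]
    exact Submodule.zero_mem _
  | succ i ih =>
    intro x hx
    rw [mem_fil_succ]
    refine fun v => ih fun l hl => ?_
    rw [toRep_apply, Matrix.mulVec, dotProduct]
    refine Finset.sum_eq_zero fun j _ => ?_
    rcases le_or_gt j l with h | h
    · rw [(r v).2 l j h, zero_mul]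
    · rw [hx j (by have : (l : ℕ) < j := h; omega), mul_zero]

/-- The linear equations for membership in `Fil (i + 1)`, and the first coordinates. -/
def flagMat (r : HomPts k g n B) (i : Fin n) : Matrix (Fin n ⊕ (g × Fin n)) (Fin n) B :=
  fun x j => Sum.elim (fun l => if l ≤ i then (1 : Matrix (Fin n) (Fin n) B) l j else 0)
    (fun x => if i ≤ x.2 then (r x.1).1 x.2 j else 0) x

/-- The concrete condition for being a flag representation. -/
def FlagCond (r : HomPts k g n B) : Prop := ∀ i, minorIdeal (flagMat r i) (Fintype.card (Fin n)) = ⊤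

theorem map_map {C D : Type u} [CommRing C] [Algebra k C] [CommRing D] [Algebra k D]
    (r : HomPts k g n B) (φ : B →ₐ[k] C) (ψ : C →ₐ[k] D) :
    (r.map φ).map ψ = r.map (ψ.comp φ) := by
  ext v i j
  rfl

theorem flagMat_map {C : Type u} [CommRing C] [Algebra k C] (r : HomPts k g n B) (φ : B →ₐ[k] C)
    (i : Fin n) : flagMat (r.map φ) i = (flagMat r i).map φ := by
  ext x j
  rcases x with l | ⟨v, l⟩
  · simp only [flagMat, Sum.elim_inl, Matrix.map_apply]
    split_ifs
    · simp only [Matrix.one_apply]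
      split_ifs <;> simp
    · simp
  · simp only [flagMat, Sum.elim_inr, Matrix.map_apply]
    split_ifs
    · rfl
    · simp

theorem FlagCond.map {C : Type u} [CommRing C] [Algebra k C] {r : HomPts k g n B}
    (h : FlagCond r) (φ : B →ₐ[k] C) : FlagCond (r.map φ) := fun i => by
  have := map_minorIdeal (φ : B →+* C) (flagMat r i) (Fintype.card (Fin n))
  rw [h i, Ideal.map_top] at this
  rw [flagMat_map]
  exact this.symm

/-- Deleting the coordinates up to `i` from `x` does not affect rows `l ≥ i` of a strictly upper
triangular matrix, since the entries in those columns vanish. -/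
theorem fil_succ_aux (r : HomPts k g n B) (i : Fin n) (h : fil r.toRep i = lo B n i)
    {x : Fin n → B} (hx : x ∈ fil r.toRep (i + 1)) (y : Fin n → B)
    (hy : ∀ j, y j = if j ≤ i then 0 else x j) (a) : flagMat r i a ⬝ᵥ y = 0 := by
  rcases a with l | ⟨v, l⟩
  · by_cases hl : l ≤ i
    · have h0 : y l = 0 := by rw [hy, if_pos hl]
      simp [flagMat, dotProduct, hl, Matrix.one_apply, h0]
    · simp [flagMat, dotProduct, hl]
  · by_cases hl : i ≤ l
    · rw [mem_fil_succ] at hx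
      have h1 := hx v
      rw [h] at h1
      rw [← h1 l hl, toRep_apply]
      refine Finset.sum_congr rfl fun j _ => ?_
      simp only [flagMat, Sum.elim_inr, hl, if_true, hy]
      split_ifs with hj
      · rw [(r v).2 l j (hj.trans hl), zero_mul, zero_mul]
      · rfl
    · simp [flagMat, dotProduct, hl]

/-- Once `Fil i` is standard, an element of `Fil (i + 1)` with its first `i + 1` coordinates deleted
lies in the kernel of `flagMat r i`, which is trivial. -/
theorem FlagCond.fil_eq {r : HomPts k g n B} (h : FlagCond r) (i : ℕ) :
    fil r.toRep i = lo B n i := by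
  induction i with
  | zero => exact le_antisymm bot_le (lo_le_fil r 0)
  | succ i ih =>
    rcases lt_or_ge i n with hi | hi
    · refine le_antisymm (fun x hx j hj => ?_) (lo_le_fil r _)
      have h1 := eq_zero_of_minorIdeal_eq_top (h ⟨i, hi⟩) (fil_succ_aux r ⟨i, hi⟩ ih hx
        (fun j => if j ≤ ⟨i, hi⟩ then 0 else x j) fun _ => rfl)
      have h2 := congrFun h1 j
      have h3 : ¬ j ≤ ⟨i, hi⟩ := fun h4 => by
        have : (j : ℕ) ≤ i := h4
        omega
      simpa [h3] using h2
    · have h1 := lo_le_fil r (i + 1)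
      rw [lo_eq_top (hi.trans (Nat.le_succ i))] at h1 ⊢
      exact top_le_iff.1 h1

theorem flagCond_of_fil_eq {K : Type u} [Field K] [Algebra k K] {r : HomPts k g n K}
    (h : ∀ i ≤ n, fil r.toRep i = lo K n i) : FlagCond r := fun i => by
  refine minorIdeal_eq_top_of_ker_eq_bot fun x hx => ?_
  have h1 : ∀ j ≤ i, x j = 0 := fun j hj => by
    have := hx (Sum.inl j)
    simpa [flagMat, dotProduct, hj, Matrix.one_apply] using this
  have h2 : x ∈ fil r.toRep (i + 1) := by
    rw [mem_fil_succ, h _ i.2.le]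
    intro v l hl
    have hl' : i ≤ l := hl
    have := hx (Sum.inr (v, l))
    simp only [flagMat, dotProduct, Sum.elim_inr, hl', if_true] at this
    exact this
  rw [h _ i.2] at h2
  funext j
  rcases le_or_gt j i with hj | hj
  · exact h1 j hj
  · exact h2 j hj

/-- The filtration contains the standard flag, so having the right dimensions forces equality with
it. -/
theorem isFlagOverField_iff {K : Type u} [Field K] [Algebra k K] (r : HomPts k g n K) :
    IsFlagOverField n r.toRep ↔ FlagCond r := by
  constructor
  · rintro ⟨-, -, h⟩
    refine flagCond_of_fil_eq fun i hi => ?_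
    exact (Submodule.eq_of_le_of_finrank_eq (lo_le_fil r i) (by rw [h i hi, finrank_lo K hi])).symm
  · intro h
    refine ⟨inferInstance, by simp, fun i hi => ?_⟩
    rw [h.fil_eq, finrank_lo K hi]

/-- Base change of a point of `Hom(g, n_n)` along an algebra map. -/
abbrev HomPts.base (r : HomPts k g n B) (C : Type u) [CommRing C] [Algebra k C] [Algebra B C]
    [IsScalarTower k B C] : HomPts k g n C := r.map (IsScalarTower.toAlgHom k B C)

theorem intertwines_base (r : HomPts k g n B) (C : Type u) [CommRing C] [Algebra k C] [Algebra B C]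
    [IsScalarTower k B C] :
    Intertwines (baseChangeRep r.toRep C) (r.base C).toRep (baseEquiv B C n) := fun v x =>
  baseEquiv_baseChange r C v x

theorem map_baseChange_lo (C : Type u) [CommRing C] [Algebra B C] (i : ℕ) :
    ((lo B n i).baseChange C).map (baseEquiv B C n : C ⊗[B] (Fin n → B) →ₗ[C] (Fin n → C)) =
      lo C n i := by
  refine le_antisymm ?_ fun x hx => ?_
  · rw [Submodule.baseChange_eq_span, Submodule.map_span, Submodule.span_le]
    rintro _ ⟨_, ⟨x, hx, rfl⟩, rfl⟩ j hj
    change baseEquiv B C n (1 ⊗ₜ x) j = 0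
    rw [baseEquiv_tmul, hx j hj, zero_smul]
  · rw [pi_eq_sum_univ' x]
    refine Submodule.sum_mem _ fun j _ => ?_
    rcases le_or_gt i j with hj | hj
    · rw [hx j hj, zero_smul]
      exact Submodule.zero_mem _
    · refine Submodule.smul_mem _ _ ⟨1 ⊗ₜ Pi.single j 1, ?_, ?_⟩
      · refine Submodule.tmul_mem_baseChange_of_mem _ fun l hl => ?_
        rw [Pi.single_apply, if_neg]
        rintro rfl
        omega
      · ext l
        change baseEquiv B C n (1 ⊗ₜ Pi.single j 1) l = _
        rw [baseEquiv_tmul]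
        simp only [Pi.single_apply]
        split_ifs <;> simp

/-- The condition on minors survives every base change and identifies the filtration with the
standard flag, whose quotients are free and whose formation commutes with base change. -/
theorem isFlag_of_flagCond {r : HomPts k g n B} (h : FlagCond r) : IsFlag n r.toRep := by
  refine ⟨⟨inferInstance, inferInstance, fun p => ?_⟩, fun i => ?_, fun C _ _ _ _ i => ?_⟩
  · have := p.nontrivial
    rw [Module.rankAtStalk_eq_finrank_of_free]
    simp
  · rw [h.fil_eq]
    have e := quotLoEquiv B n i
    have : Module.Free B ((Fin n → B) ⧸ lo B n i) := Module.Free.of_equiv e.symm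
    refine ⟨Module.Finite.equiv e.symm, inferInstance, fun p => ?_⟩
    have := p.nontrivial
    rw [Module.rankAtStalk_eq_finrank_of_free]
    exact finrank_quot_lo B n i
  · have h1 := (intertwines_base r C).map_fil i
    rw [(h.map _).fil_eq, ← map_baseChange_lo (B := B)] at h1
    rw [h.fil_eq]
    exact Submodule.map_injective_of_injective (baseEquiv B C n).injective h1

/-- The fiber of `E / Fil i` has dimension `n - i` and, by right exactness, is the quotient of the
fiber of `E` by the base changed `Fil i`, which is step `i` of the filtration of the fiber. -/
theorem IsFlag.isFlagOverField_base {A E : Type u} [CommRing A] [Algebra k A] [AddCommGroup E]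
    [Module A E] [Module k E] [IsScalarTower k A E] {ρ : g →ₗ⁅k⁆ Module.End A E} (h : IsFlag n ρ)
    (p : PrimeSpectrum A) :
    IsFlagOverField n (baseChangeRep ρ p.asIdeal.ResidueField) := by
  obtain ⟨⟨h1, h2, h3⟩, h4, h5⟩ := h
  have hE : Module.finrank p.asIdeal.ResidueField (p.asIdeal.ResidueField ⊗[A] E) = n :=
    (Module.rankAtStalk_eq p).symm.trans (h3 p)
  refine ⟨inferInstance, hE, fun i hi => ?_⟩
  obtain ⟨h6, h7, h8⟩ := h4 i
  have hQ : Module.finrank p.asIdeal.ResidueField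
      (p.asIdeal.ResidueField ⊗[A] (E ⧸ fil ρ i)) = n - i :=
    (Module.rankAtStalk_eq p).symm.trans (h8 p)
  have e := TensorProduct.AlgebraTensorModule.tensorQuotientEquiv (R := A) p.asIdeal.ResidueField A
    p.asIdeal.ResidueField (fil ρ i)
  have he := e.finrank_eq
  rw [hQ] at he
  have := Submodule.finrank_quotient_add_finrank
    ((fil ρ i).baseChange p.asIdeal.ResidueField)
  rw [hE] at this
  have he' : Module.finrank p.asIdeal.ResidueField ((p.asIdeal.ResidueField ⊗[A] E) ⧸
    ((fil ρ i).baseChange p.asIdeal.ResidueField)) = n - i := he.symm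
  rw [h5]
  omega

/-- The fibers of a flag family are flag, and over a field this yields the condition on minors; an
ideal that is the unit ideal on every fiber is the unit ideal. -/
theorem isFlag_iff (r : HomPts k g n B) : IsFlag n r.toRep ↔ FlagCond r := by
  refine ⟨fun h i => ideal_eq_top_of_residueField fun p => ?_, isFlag_of_flagCond⟩
  have h1 := (intertwines_base r _).isFlagOverField (h.isFlagOverField_base p)
  rw [isFlagOverField_iff] at h1
  have h2 := h1 i
  rw [flagMat_map] at h2
  rw [map_minorIdeal]
  exact h2

end Flags
end NilpRep

namespace NilpRep

/-! ### The sub and quotient representations as matrix blocks -/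

section Truncation

variable {k : Type u} [Field k] {g : Type v} [LieRing g] [LieAlgebra k g] {n : ℕ}
variable {B : Type u} [CommRing B] [Algebra k B]

/-- The upper left block. -/
def HomPts.upperLeft (r : HomPts k g (n + 1) B) : HomPts k g n B where
  toFun v := ⟨(r v).1.submatrix Fin.castSucc Fin.castSucc, fun i j h =>
    (r v).2 _ _ (Fin.castSucc_le_castSucc_iff.2 h)⟩
  map_add' v w := by ext i j; simp
  map_smul' c v := by ext i j; simp
  map_lie' {v w} := by
    ext i j
    have h : ∀ (M : strictUpper k (n + 1) B) (j : Fin n), M.1 (Fin.last n) j.castSucc = 0 :=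
      fun M j => M.2 _ _ (Fin.le_last _)
    simp [LieRing.of_associative_ring_bracket, Matrix.mul_apply, Fin.sum_univ_castSucc, h]

/-- The lower right block. -/
def HomPts.lowerRight (r : HomPts k g (n + 1) B) : HomPts k g n B where
  toFun v := ⟨(r v).1.submatrix Fin.succ Fin.succ, fun i j h =>
    (r v).2 _ _ (Fin.succ_le_succ_iff.2 h)⟩
  map_add' v w := by ext i j; simp
  map_smul' c v := by ext i j; simp
  map_lie' {v w} := by
    ext i j
    have h : ∀ (M : strictUpper k (n + 1) B) (j : Fin n), M.1 j.succ 0 = 0 :=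
      fun M j => M.2 _ _ (Fin.zero_le _)
    simp [LieRing.of_associative_ring_bracket, Matrix.mul_apply, Fin.sum_univ_succ, h]

theorem map_upperLeft {C : Type u} [CommRing C] [Algebra k C] (r : HomPts k g (n + 1) B)
    (φ : B →ₐ[k] C) : (r.map φ).upperLeft = r.upperLeft.map φ := rfl

theorem map_lowerRight {C : Type u} [CommRing C] [Algebra k C] (r : HomPts k g (n + 1) B)
    (φ : B →ₐ[k] C) : (r.map φ).lowerRight = r.lowerRight.map φ := rfl

/-- The first step of codimension one of the standard flag. -/
def loEquiv (B : Type u) [CommRing B] (n : ℕ) : lo B (n + 1) n ≃ₗ[B] (Fin n → B) where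
  toFun x := x.1 ∘ Fin.castSucc
  map_add' x y := rfl
  map_smul' c x := rfl
  invFun y := ⟨Fin.snoc y 0, fun j hj => by
    obtain rfl : j = Fin.last n := Fin.ext (by have := j.2; simp only [Fin.val_last]; omega)
    simp⟩
  left_inv x := by
    ext j
    refine Fin.lastCases ?_ (fun j => ?_) j
    · simp [x.2 (Fin.last n) le_rfl]
    · simp
  right_inv y := by
    ext j
    simp

theorem FlagCond.intertwines_filSub {r : HomPts k g (n + 1) B} (h : FlagCond r) :
    Intertwines (filSub r.toRep n) r.upperLeft.toRep
      ((LinearEquiv.ofEq _ _ (h.fil_eq n)).trans (loEquiv B n)) := by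
  intro v x
  ext i
  have hx : x.1 (Fin.last n) = 0 := (h.fil_eq n).le x.2 (Fin.last n) le_rfl
  change r.toRep v x.1 i.castSucc = r.upperLeft.toRep v (x.1 ∘ Fin.castSucc) i
  rw [toRep_apply, toRep_apply, Matrix.mulVec, dotProduct, Fin.sum_univ_castSucc, hx, mul_zero,
    add_zero]
  rfl

/-- The quotient by the first step of the standard flag. -/
noncomputable def quotLoOneEquiv (B : Type u) [CommRing B] (n : ℕ) :
    ((Fin (n + 1) → B) ⧸ lo B (n + 1) 1) ≃ₗ[B] (Fin n → B) :=
  (Submodule.quotEquivOfEq _ _ (by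
    ext x
    rw [mem_lo, LinearMap.mem_ker, funext_iff]
    constructor
    · intro h j
      exact h j.succ (by simp)
    · intro h j hj
      obtain ⟨j, rfl⟩ := Fin.exists_succ_eq.2 (show j ≠ 0 by rintro rfl; simp at hj)
      exact h j)).trans (LinearMap.quotKerEquivOfSurjective (LinearMap.funLeft B B Fin.succ)
      (LinearMap.funLeft_surjective_of_injective _ _ _ (Fin.succ_injective n)))

theorem FlagCond.intertwines_filQuot {r : HomPts k g (n + 1) B} (h : FlagCond r) :
    Intertwines (filQuot r.toRep 1) r.lowerRight.toRep
      ((Submodule.quotEquivOfEq _ _ (h.fil_eq 1)).trans (quotLoOneEquiv B n)) := by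
  intro v x
  obtain ⟨x, rfl⟩ := Submodule.mkQ_surjective _ x
  ext i
  change r.toRep v x i.succ = r.lowerRight.toRep v (x ∘ Fin.succ) i
  rw [toRep_apply, toRep_apply, Matrix.mulVec, dotProduct, Fin.sum_univ_succ,
    (r v).2 _ _ (Fin.zero_le _), zero_mul, zero_add]
  rfl

end Truncation

/-! ### Equations and open conditions for nondegeneracy -/

section Nondegeneracy

variable {k : Type u} [Field k] {g : Type v} [LieRing g] [LieAlgebra k g]

variable (k g) in
/-- The dimensions of automorphism group schemes over which minimality is required in the
definition of nondegenerate representations of dimension `n + 2`. -/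
def autDims (n : ℕ) : Set (WithBot ℕ∞) :=
  {d | ∃ (K V : Type u) (_ : Field K) (_ : Algebra k K) (_ : AddCommGroup V) (_ : Module K V)
    (_ : Module k V) (_ : IsScalarTower k K V) (ρ : g →ₗ⁅k⁆ Module.End K V),
    IsFlagOverField (n + 2) ρ ∧
      IsNondegOverField k g (n + 1) K (fil ρ (n + 1)) (filSub ρ (n + 1)) ∧
      IsNondegOverField k g (n + 1) K (V ⧸ fil ρ 1) (filQuot ρ 1) ∧ HasAutDim ρ d}

variable {S : Type*} {s : S → g} {n : ℕ}

theorem isNondegOverField_add_two_iff (hs : LieSubalgebra.lieSpan k g (Set.range s) = ⊤)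
    {K : Type u} [Field K] [Algebra k K] (r : HomPts k g (n + 2) K) :
    IsNondegOverField k g (n + 2) K _ r.toRep ↔ FlagCond r ∧
      IsNondegOverField k g (n + 1) K _ r.upperLeft.toRep ∧
      IsNondegOverField k g (n + 1) K _ r.lowerRight.toRep ∧
      IsLeast (autDims k g n) (Module.finrank K (CommMod (r.mats s)) : WithBot ℕ∞) := by
  constructor
  · rintro ⟨⟨h1, h2, h3⟩, d, hd, hmin⟩
    have hflag := (isFlagOverField_iff r).1 h1
    refine ⟨hflag, hflag.intertwines_filSub.isNondegOverField h2,
      hflag.intertwines_filQuot.isNondegOverField h3, ?_⟩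
    rw [← (hasAutDim_iff hs r d).1 hd]
    refine ⟨⟨K, _, _, _, _, _, _, _, r.toRep, h1, h2, h3, hd⟩, ?_⟩
    rintro d' ⟨K', V', _, _, _, _, _, _, ρ', h1', h2', h3', hd'⟩
    exact hmin K' V' ρ' d' h1' h2' h3' hd'
  · rintro ⟨hflag, h2, h3, hleast⟩
    refine ⟨⟨(isFlagOverField_iff r).2 hflag, hflag.intertwines_filSub.symm.isNondegOverField h2,
      hflag.intertwines_filQuot.symm.isNondegOverField h3⟩, _, (hasAutDim_iff hs r _).2 rfl, ?_⟩
    intro K' V' _ _ _ _ _ _ ρ' d' h1' h2' h3' hd'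
    exact hleast.2 ⟨K', V', _, _, _, _, _, _, ρ', h1', h2', h3', hd'⟩

theorem IsNondeg.fiber {n : ℕ} {A E : Type u} [CommRing A] [Algebra k A] [AddCommGroup E]
    [Module A E] [Module k E] [IsScalarTower k A E] {ρ : g →ₗ⁅k⁆ Module.End A E}
    (h : IsNondeg k g n A E ρ) (p : PrimeSpectrum A) :
    IsNondegOverField k g n p.asIdeal.ResidueField (p.asIdeal.ResidueField ⊗[A] E)
      (baseChangeRep ρ p.asIdeal.ResidueField) := by
  match n with
  | 0 => exact h.2.1 p
  | n + 1 => exact h.2.2.1 p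

variable {B : Type u} [CommRing B] [Algebra k B]

/-- Nondegeneracy of the blocks already contains that of their fibers, so from the fiberwise
condition only minimality of the dimension remains. -/
theorem isNondeg_add_two_iff [Fintype S] (hs : LieSubalgebra.lieSpan k g (Set.range s) = ⊤)
    (r : HomPts k g (n + 2) B) : IsNondeg k g (n + 2) B _ r.toRep ↔ FlagCond r ∧
      IsNondeg k g (n + 1) B _ r.upperLeft.toRep ∧ IsNondeg k g (n + 1) B _ r.lowerRight.toRep ∧
      (∃ U : Matrix (Fin (n + 2) × Fin (n + 2)) (S × Fin (n + 2) × Fin (n + 2)) B,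
        commMat (r.mats s) * U * commMat (r.mats s) = commMat (r.mats s)) ∧
      ∀ p : PrimeSpectrum B, IsLeast (autDims k g n) (Module.finrank p.asIdeal.ResidueField
        (CommMod ((r.base p.asIdeal.ResidueField).mats s)) : WithBot ℕ∞) := by
  rw [← autFlat_iff hs]
  constructor
  · rintro ⟨h1, ⟨h2, h3⟩, h4, h5⟩
    have hflag := (isFlag_iff r).1 h1
    refine ⟨hflag, hflag.intertwines_filSub.isNondeg h2, hflag.intertwines_filQuot.isNondeg h3,
      h5, fun p => ?_⟩
    exact ((isNondegOverField_add_two_iff hs _).1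
      ((intertwines_base r _).isNondegOverField (h4 p))).2.2.2
  · rintro ⟨hflag, h2, h3, h5, hleast⟩
    refine ⟨(isFlag_iff r).2 hflag, ⟨hflag.intertwines_filSub.symm.isNondeg h2,
      hflag.intertwines_filQuot.symm.isNondeg h3⟩, fun p => ?_, h5⟩
    refine (intertwines_base r _).symm.isNondegOverField
      ((isNondegOverField_add_two_iff hs _).2 ⟨hflag.map _, ?_, ?_, hleast p⟩)
    · exact (intertwines_base r.upperLeft _).isNondegOverField (h2.fiber p)
    · exact (intertwines_base r.lowerRight _).isNondegOverField (h3.fiber p)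

theorem flagCond_of_residueField {r : HomPts k g n B}
    (h : ∀ p : PrimeSpectrum B, FlagCond (r.base p.asIdeal.ResidueField)) : FlagCond r := fun i =>
  ideal_eq_top_of_residueField fun p => by
    have := h p i
    rw [flagMat_map] at this
    rw [map_minorIdeal]
    exact this

theorem toRep_eq_zero (r : HomPts k g 1 B) : r.toRep = 0 := by
  ext v i j
  obtain rfl := Subsingleton.elim i j
  simp [toRep_apply, (r v).2 i i le_rfl]

theorem flagCond_one (r : HomPts k g 1 B) : FlagCond r := by
  refine flagCond_of_residueField fun p => flagCond_of_fil_eq fun i hi => ?_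
  refine le_antisymm ?_ (lo_le_fil _ _)
  match i, hi with
  | 0, _ => exact bot_le
  | 1, _ =>
    rw [lo_eq_top le_rfl]
    exact le_top

theorem isNondeg_zero (r : HomPts k g 0 B) (hg : ∃ s : Finset g, LieSubalgebra.lieSpan k g (s : Set g) = ⊤) :
    IsNondeg k g 0 B _ r.toRep := by
  obtain ⟨s, hs⟩ := hg
  have hs' : LieSubalgebra.lieSpan k g (Set.range ((↑) : s → g)) = ⊤ := by simpa using hs
  have hflag : ∀ {C : Type u} [CommRing C] [Algebra k C] (r : HomPts k g 0 C), FlagCond r :=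
    fun r i => i.elim0
  refine ⟨(isFlag_iff r).2 (hflag r), fun p => ?_, (autFlat_iff hs' r).2 ⟨0, ?_⟩⟩
  · exact (intertwines_base r _).symm.isFlagOverField ((isFlagOverField_iff _).2 (hflag _))
  · ext i j
    exact j.1.elim0

theorem isNondeg_one (r : HomPts k g 1 B) (hg : ∃ s : Finset g, LieSubalgebra.lieSpan k g (s : Set g) = ⊤) :
    IsNondeg k g 1 B _ r.toRep := by
  have hflag := flagCond_one r
  refine ⟨(isFlag_iff r).2 hflag,
    ⟨hflag.intertwines_filSub.symm.isNondeg (isNondeg_zero _ hg),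
      hflag.intertwines_filQuot.symm.isNondeg (isNondeg_zero _ hg)⟩, fun p => ?_, ?_⟩
  · exact (intertwines_base r _).symm.isNondegOverField
      ⟨(isFlagOverField_iff _).2 (flagCond_one _), toRep_eq_zero _⟩
  · obtain ⟨s, hs⟩ := hg
    have hs' : LieSubalgebra.lieSpan k g (Set.range ((↑) : s → g)) = ⊤ := by simpa using hs
    refine (autFlat_iff hs' r).2 ⟨0, ?_⟩
    ext x y
    have h : ∀ v i j, (r v).1 i j = 0 := fun v i j => (r v).2 i j (Subsingleton.elim j i).le
    simp [commMat, HomPts.mats, h]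

theorem map_mats {C : Type u} [CommRing C] [Algebra k C] (r : HomPts k g n B) (φ : B →ₐ[k] C) :
    (r.map φ).mats s = fun i => (r.mats s i).map (φ : B →+* C) := rfl

/-- The ideal whose vanishing locus is the complement of the flag locus. -/
noncomputable def flagIdeal (r : HomPts k g n B) : Ideal B :=
  ∏ i, minorIdeal (flagMat r i) (Fintype.card (Fin n))

theorem ideal_prod_eq_top_iff {ι : Type*} [Fintype ι] (I : ι → Ideal B) :
    ∏ i, I i = ⊤ ↔ ∀ i, I i = ⊤ := by
  simp only [← Ideal.isUnit_iff, IsUnit.prod_univ_iff]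

theorem ideal_mul_eq_top_iff {I J : Ideal B} : I * J = ⊤ ↔ I = ⊤ ∧ J = ⊤ := by
  simp only [← Ideal.isUnit_iff, IsUnit.mul_iff]

theorem map_flagIdeal_eq_top_iff {C : Type u} [CommRing C] [Algebra k C] (r : HomPts k g n B)
    (φ : B →ₐ[k] C) : (flagIdeal r).map (φ : B →+* C) = ⊤ ↔ FlagCond (r.map φ) := by
  rw [flagIdeal, ← Ideal.mapHom_apply, map_prod, ideal_prod_eq_top_iff, FlagCond]
  simp only [Ideal.mapHom_apply, map_minorIdeal, flagMat_map]
  rfl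

/-- The spectrum of the zero ring is empty, so it has points in every locus. This is what the
description of an empty nondegenerate locus by ideals requires. -/
theorem isNondeg_of_subsingleton [Fintype S] (hs : LieSubalgebra.lieSpan k g (Set.range s) = ⊤)
    [Subsingleton B] : ∀ {n : ℕ} (r : HomPts k g n B), IsNondeg k g n B _ r.toRep
  | 0, r => isNondeg_zero r ⟨(Set.finite_range s).toFinset, by simpa using hs⟩
  | 1, r => isNondeg_one r ⟨(Set.finite_range s).toFinset, by simpa using hs⟩
  | n + 2, r => (isNondeg_add_two_iff hs r).2 ⟨fun i => Subsingleton.elim _ _,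
      isNondeg_of_subsingleton hs _, isNondeg_of_subsingleton hs _,
      ⟨0, by ext; exact Subsingleton.elim _ _⟩, fun p =>
        (not_nontrivial_iff_subsingleton.2 ‹_› p.nontrivial).elim⟩

theorem finrank_commMod_add {K : Type u} [Field K] (ν : S → Matrix (Fin n) (Fin n) K) :
    Module.finrank K (CommMod ν) +
      Module.finrank K (Submodule.span K (Set.range (commMat ν).row)) = n * n := by
  rw [finrank_rowCoker_add, Fintype.card_prod, Fintype.card_fin]

/-- The condition that the matrix of the equations for the commutant is regular with fibers of
corank `d`. -/
theorem regular_and_finrank_commMod_iff [Fintype S] (r : HomPts k g n B) {d : ℕ}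
    (hd : d ≤ n * n) :
    ((∃ U : Matrix (Fin n × Fin n) (S × Fin n × Fin n) B,
        commMat (r.mats s) * U * commMat (r.mats s) = commMat (r.mats s)) ∧
      ∀ p : PrimeSpectrum B, Module.finrank p.asIdeal.ResidueField
        (CommMod ((r.base p.asIdeal.ResidueField).mats s)) = d) ↔
    minorIdeal (commMat (r.mats s)) (n * n - d) = ⊤ ∧
      schurIdeal (commMat (r.mats s)) (n * n - d) = ⊥ := by
  rw [← regular_and_finrank_iff]
  refine and_congr_right fun _ => forall_congr' fun p => ?_
  have h := finrank_commMod_add ((r.base p.asIdeal.ResidueField).mats s)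
  have heq : commMat ((r.base p.asIdeal.ResidueField).mats s) =
    (commMat (r.mats s)).map (algebraMap B p.asIdeal.ResidueField) := commMat_map _ _
  rw [← heq]
  omega

/-- The locus of nondegenerate representations is locally closed. -/
theorem exists_ideals_isNondeg [Fintype S] (hs : LieSubalgebra.lieSpan k g (Set.range s) = ⊤) :
    ∀ {n : ℕ} {B : Type u} [CommRing B] [Algebra k B] (r : HomPts k g n B),
      ∃ I J : Ideal B, ∀ (C : Type u) [CommRing C] [Algebra k C] (φ : B →ₐ[k] C),
        IsNondeg k g n C _ (r.map φ).toRep ↔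
          I.map (φ : B →+* C) = ⊥ ∧ J.map (φ : B →+* C) = ⊤
  | 0, B, _, _, r => ⟨⊥, ⊤, fun C _ _ φ => by
      simp only [Ideal.map_bot, Ideal.map_top, and_self, iff_true]
      exact isNondeg_zero _ ⟨(Set.finite_range s).toFinset, by simpa using hs⟩⟩
  | 1, B, _, _, r => ⟨⊥, ⊤, fun C _ _ φ => by
      simp only [Ideal.map_bot, Ideal.map_top, and_self, iff_true]
      exact isNondeg_one _ ⟨(Set.finite_range s).toFinset, by simpa using hs⟩⟩
  | n + 2, B, _, _, r => by
    -- The set of dimensions can be empty, for instance when `g = 0`. The bound on `d` makes the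
    -- truncated subtraction giving the size of the minors a genuine one.
    by_cases hex : ∃ d : ℕ, d ≤ (n + 2) * (n + 2) ∧ IsLeast (autDims k g n) (d : WithBot ℕ∞)
    · obtain ⟨d, hd, hleast⟩ := hex
      obtain ⟨I₁, J₁, h₁⟩ := exists_ideals_isNondeg hs r.upperLeft
      obtain ⟨I₂, J₂, h₂⟩ := exists_ideals_isNondeg hs r.lowerRight
      refine ⟨I₁ ⊔ I₂ ⊔ schurIdeal (commMat (r.mats s)) ((n + 2) * (n + 2) - d),
        J₁ * J₂ * flagIdeal r * minorIdeal (commMat (r.mats s)) ((n + 2) * (n + 2) - d),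
        fun C _ _ φ => ?_⟩
      have hiff : ∀ m : ℕ, IsLeast (autDims k g n) (m : WithBot ℕ∞) ↔ m = d := fun m =>
        ⟨fun h => by exact_mod_cast h.unique hleast, fun h => h ▸ hleast⟩
      have hrank := regular_and_finrank_commMod_iff (s := s) (r.map φ) hd
      rw [map_mats, commMat_map, ← map_minorIdeal, ← map_schurIdeal] at hrank
      rw [isNondeg_add_two_iff hs, map_upperLeft, map_lowerRight, h₁, h₂,
        ← map_flagIdeal_eq_top_iff]
      simp only [hiff]
      rw [map_mats, commMat_map, hrank]
      simp only [Ideal.map_sup, Ideal.map_mul, sup_eq_bot_iff, ideal_mul_eq_top_iff]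
      tauto
    -- With both ideals zero, the conditions hold only over the zero ring. A nondegenerate point
    -- over a nonzero ring would have a fiber, whose commutant realizes a minimal dimension within
    -- the bound.
    · refine ⟨⊥, ⊥, fun C _ _ φ => ?_⟩
      rw [Ideal.map_bot]
      constructor
      · intro h
        refine ⟨rfl, ?_⟩
        by_contra hC
        have : Nontrivial C := by
          by_contra hne
          rw [not_nontrivial_iff_subsingleton] at hne
          exact hC (Subsingleton.elim _ _)
        obtain ⟨p⟩ : Nonempty (PrimeSpectrum C) := inferInstance
        refine hex ⟨_, ?_, ((isNondeg_add_two_iff hs _).1 h).2.2.2.2 p⟩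
        exact (Nat.le_add_right _ _).trans (finrank_commMod_add _).le
      · rintro ⟨-, h⟩
        have : Subsingleton C := (Submodule.subsingleton_iff C).1 (subsingleton_of_bot_eq_top h)
        exact isNondeg_of_subsingleton hs _

end Nondegeneracy
end NilpRep

namespace NilpRep

/-! ### The coordinate ring of the space of homomorphisms -/

section Universal

variable (k : Type u) [Field k] (g : Type v) [LieRing g] [LieAlgebra k g] (n : ℕ)

open MvPolynomial in
/-- The relations satisfied by the matrix entries of a point of `Hom(g, n_n)`. -/
inductive EntryRel : MvPolynomial (g × Fin n × Fin n) k → Prop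
  | upper (v : g) (i j : Fin n) (h : j ≤ i) : EntryRel (X (v, i, j))
  | add (v w : g) (i j : Fin n) : EntryRel (X (v + w, i, j) - (X (v, i, j) + X (w, i, j)))
  | smul (c : k) (v : g) (i j : Fin n) : EntryRel (X (c • v, i, j) - C c * X (v, i, j))
  | lie (v w : g) (i j : Fin n) : EntryRel (X (⁅v, w⁆, i, j) -
      (∑ l, X (v, i, l) * X (w, l, j) - ∑ l, X (w, i, l) * X (v, l, j)))

/-- The coordinate ring of `Hom(g, n_n)`, generated by the matrix entries of all elements. -/
abbrev EntryRing : Type (max u v) :=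
  MvPolynomial (g × Fin n × Fin n) k ⧸ Ideal.span {p | EntryRel k g n p}

variable {g n}

/-- The universal matrix entries. -/
noncomputable def entry (v : g) (i j : Fin n) : EntryRing k g n :=
  Ideal.Quotient.mk _ (MvPolynomial.X (v, i, j))

variable {k}

theorem entry_upper (v : g) {i j : Fin n} (h : j ≤ i) : entry k v i j = 0 :=
  Ideal.Quotient.eq_zero_iff_mem.2 (Ideal.subset_span (EntryRel.upper v i j h))

theorem entry_add (v w : g) (i j : Fin n) : entry k (v + w) i j = entry k v i j + entry k w i j :=
  (Ideal.Quotient.eq.2 (Ideal.subset_span (EntryRel.add v w i j))).trans (map_add _ _ _)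

theorem entry_smul (c : k) (v : g) (i j : Fin n) : entry k (c • v) i j = c • entry k v i j :=
  (Ideal.Quotient.eq.2 (Ideal.subset_span (EntryRel.smul c v i j))).trans (by
    rw [map_mul]
    exact (Algebra.smul_def c (entry k v i j)).symm)

theorem entry_lie (v w : g) (i j : Fin n) : entry k ⁅v, w⁆ i j =
    ∑ l, entry k v i l * entry k w l j - ∑ l, entry k w i l * entry k v l j :=
  (Ideal.Quotient.eq.2 (Ideal.subset_span (EntryRel.lie v w i j))).trans (by
    simp only [map_sub, map_sum, map_mul]
    rfl)

/-- The point of `Hom(g, n_n)` given by a map out of the coordinate ring. -/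
noncomputable def entryPoint {B : Type u} [CommRing B] [Algebra k B] (φ : EntryRing k g n →ₐ[k] B) :
    HomPts k g n B where
  toFun v := ⟨Matrix.of fun i j => φ (entry k v i j), fun i j h => by simp [entry_upper v h]⟩
  map_add' v w := by ext i j; simp [entry_add]
  map_smul' c v := by ext i j; simp [entry_smul]
  map_lie' {v w} := by
    ext i j
    simp [entry_lie, LieRing.of_associative_ring_bracket, Matrix.mul_apply]

theorem entryPoint_map {B C : Type u} [CommRing B] [Algebra k B] [CommRing C] [Algebra k C]
    (φ : EntryRing k g n →ₐ[k] B) (ψ : B →ₐ[k] C) :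
    (entryPoint φ).map ψ = entryPoint (ψ.comp φ) := rfl

theorem entryPoint_bijective {B : Type u} [CommRing B] [Algebra k B] :
    Function.Bijective (entryPoint : (EntryRing k g n →ₐ[k] B) → HomPts k g n B) := by
  constructor
  · intro φ ψ h
    refine Ideal.Quotient.algHom_ext _ (MvPolynomial.algHom_ext fun ⟨v, i, j⟩ => ?_)
    exact congrArg (fun r : HomPts k g n B => (r v).1 i j) h
  · intro r
    refine ⟨Ideal.Quotient.liftₐ _ (MvPolynomial.aeval fun x => (r x.1).1 x.2.1 x.2.2) ?_, ?_⟩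
    · intro a ha
      rw [← RingHom.mem_ker]
      revert a
      change _ ≤ RingHom.ker _
      rw [Ideal.span_le]
      rintro _ (⟨v, i, j, h⟩ | ⟨v, w, i, j⟩ | ⟨c, v, i, j⟩ | ⟨v, w, i, j⟩)
      · simp [(r v).2 i j h]
      · simp
      · simp [Algebra.smul_def]
      · simp [LieRing.of_associative_ring_bracket, Matrix.mul_apply]
    · ext v i j
      exact MvPolynomial.aeval_X (fun x : g × Fin n × Fin n => (r x.1).1 x.2.1 x.2.2) (v, i, j)

/-- The elements whose entries lie in the subalgebra generated by the entries of the generators form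
a Lie subalgebra, because the entries of a bracket are polynomials in those of its terms. -/
theorem finiteType_entryRing (hg : ∃ s : Finset g, LieSubalgebra.lieSpan k g (s : Set g) = ⊤) :
    Algebra.FiniteType k (EntryRing k g n) := by
  obtain ⟨s, hs⟩ := hg
  let T : Set (EntryRing k g n) := Set.range fun x : s × Fin n × Fin n => entry k x.1.1 x.2.1 x.2.2
  let A := Algebra.adjoin k T
  let L : LieSubalgebra k g :=
    { carrier := {v | ∀ i j, entry k v i j ∈ A}
      add_mem' := fun {v w} hv hw i j => by
        rw [entry_add]
        exact A.add_mem (hv i j) (hw i j)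
      zero_mem' := fun i j => by
        have := entry_smul (0 : k) (0 : g) i j
        rw [zero_smul, zero_smul] at this
        rw [this]
        exact A.zero_mem
      smul_mem' := fun c v hv i j => by
        rw [entry_smul]
        exact A.smul_mem (hv i j) c
      lie_mem' := fun {v w} hv hw i j => by
        rw [entry_lie]
        exact A.sub_mem (A.sum_mem fun l _ => A.mul_mem (hv i l) (hw l j))
          (A.sum_mem fun l _ => A.mul_mem (hw i l) (hv l j)) }
  have hL : L = ⊤ := by
    rw [← top_le_iff, ← hs, LieSubalgebra.lieSpan_le]
    exact fun v hv i j => Algebra.subset_adjoin ⟨(⟨v, hv⟩, i, j), rfl⟩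
  have hA : A = ⊤ := by
    rw [eq_top_iff]
    rintro x -
    obtain ⟨p, rfl⟩ := Ideal.Quotient.mk_surjective x
    induction p using MvPolynomial.induction_on with
    | C a => exact A.algebraMap_mem a
    | add p q hp hq =>
      rw [map_add]
      exact A.add_mem hp hq
    | mul_X p x hp =>
      rw [map_mul]
      exact A.mul_mem hp ((hL ▸ LieSubalgebra.mem_top x.1 : x.1 ∈ L) x.2.1 x.2.2)
  refine ⟨⟨(Set.finite_range fun x : s × Fin n × Fin n =>
    entry k x.1.1 x.2.1 x.2.2).toFinset, ?_⟩⟩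
  rw [Set.Finite.coe_toFinset]
  exact hA

/-- The functor `Hom(g, n_n)` is represented by an algebra of finite type. -/
theorem exists_universal (hg : ∃ s : Finset g, LieSubalgebra.lieSpan k g (s : Set g) = ⊤) (n : ℕ) :
    ∃ (R : Type u) (_ : CommRing R) (_ : Algebra k R) (_ : Algebra.FiniteType k R)
      (r : HomPts k g n R), ∀ (B : Type u) [CommRing B] [Algebra k B],
        Function.Bijective fun φ : R →ₐ[k] B => r.map φ := by
  have := finiteType_entryRing (n := n) hg
  -- A presentation by finitely many variables replaces the large coordinate ring by an isomorphic
  -- one in the universe of `k`.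
  obtain ⟨m, f, hf⟩ := Algebra.FiniteType.iff_quotient_mvPolynomial''.1 this
  let e := Ideal.quotientKerAlgEquivOfSurjective hf
  refine ⟨MvPolynomial (Fin m) k ⧸ RingHom.ker f, inferInstance, inferInstance, inferInstance,
    entryPoint e.symm.toAlgHom, fun B _ _ => ?_⟩
  simp only [entryPoint_map]
  refine entryPoint_bijective.comp ⟨fun φ ψ h => ?_, fun φ => ⟨φ.comp e.toAlgHom, ?_⟩⟩
  · ext1 x
    have := DFunLike.congr_fun h (e x)
    simpa using this
  · ext1 x
    simp

end Universal
end NilpRep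

namespace NilpRep

/-! ### Locally closed subschemes of affine schemes, and projective embeddings -/

section Schemes

variable {k : Type u} [Field k]

theorem specOverMap_left {B C : Type u} [CommRing B] [Algebra k B] [CommRing C] [Algebra k C]
    (φ : B →ₐ[k] C) : (specOverMap φ).left = Spec.map (CommRingCat.ofHom φ.toRingHom) := rfl

theorem specOverMap_comp {B C D : Type u} [CommRing B] [Algebra k B] [CommRing C] [Algebra k C]
    [CommRing D] [Algebra k D] (φ : B →ₐ[k] C) (ψ : C →ₐ[k] D) :
    specOverMap ψ ≫ specOverMap φ = specOverMap (ψ.comp φ) := by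
  ext1
  rw [Over.comp_left, specOverMap_left, specOverMap_left, specOverMap_left, ← Spec.map_comp,
    ← CommRingCat.ofHom_comp]
  rfl

theorem specOverMap_bijective (B C : Type u) [CommRing B] [Algebra k B] [CommRing C]
    [Algebra k C] :
    Function.Bijective (specOverMap : (B →ₐ[k] C) → (specOver k C ⟶ specOver k B)) := by
  constructor
  · intro φ ψ h
    have h1 := congrArg (fun f => f.left) h
    simp only [specOverMap_left] at h1
    have h2 := congrArg CommRingCat.Hom.hom (Spec.map_injective h1)
    ext x
    exact RingHom.congr_fun h2 x
  · intro f
    obtain ⟨φ, hφ⟩ := Spec.map_surjective f.left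
    have hw := Over.w f
    rw [← hφ] at hw
    have h1 := hw
    simp only [Over.mk_hom, Over.mk_left] at h1
    rw [← Spec.map_comp] at h1
    have h2 := congrArg CommRingCat.Hom.hom (Spec.map_injective h1)
    refine ⟨{ φ.hom with commutes' := fun c => RingHom.congr_fun h2 c }, ?_⟩
    ext1
    exact hφ

/-- The complement of the zero locus of an ideal. -/
def idealOpen {R : Type u} [CommRing R] (J : Ideal R) : (Spec (CommRingCat.of R)).Opens :=
  ⟨(PrimeSpectrum.zeroLocus (J : Set R))ᶜ, (PrimeSpectrum.isClosed_zeroLocus _).isOpen_compl⟩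

/-- A proper extension of `J` lies in a maximal ideal, which is a point mapping into the zero locus.
-/
theorem range_subset_idealOpen_iff {R B : Type u} [CommRing R] [CommRing B] (J : Ideal R)
    (φ : R →+* B) :
    Set.range (Spec.map (CommRingCat.ofHom φ)) ⊆ (idealOpen J : Set (Spec (CommRingCat.of R))) ↔
      J.map φ = ⊤ := by
  constructor
  · intro h
    by_contra hJ
    obtain ⟨m, hm, hle⟩ := Ideal.exists_le_maximal _ hJ
    have := h ⟨⟨m, hm.isPrime⟩, rfl⟩
    exact this (Ideal.map_le_iff_le_comap.1 hle)
  · rintro h _ ⟨q, rfl⟩ hq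
    have : J.map φ ≤ q.asIdeal := Ideal.map_le_iff_le_comap.2 hq
    exact q.isPrime.ne_top (top_le_iff.1 (h ▸ this))

/-- The open subscheme of `Spec R` where the ideal `J` is the unit ideal. -/
noncomputable def openLocus (k : Type u) [Field k] {R : Type u} [CommRing R] [Algebra k R]
    (J : Ideal R) : Over (Spec (CommRingCat.of k)) :=
  Over.mk ((idealOpen J).ι ≫ Spec.map (CommRingCat.ofHom (algebraMap k R)))

/-- The inclusion of an open subscheme. -/
noncomputable def openLocusMap (k : Type u) [Field k] {R : Type u} [CommRing R] [Algebra k R]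
    (J : Ideal R) : openLocus k J ⟶ specOver k R :=
  Over.homMk (U := openLocus k J) (V := specOver k R) (idealOpen J).ι rfl

instance {R : Type u} [CommRing R] [Algebra k R] (J : Ideal R) :
    IsOpenImmersion (openLocusMap k J).left :=
  inferInstanceAs (IsOpenImmersion (idealOpen J).ι)

theorem exists_lift_openLocusMap_iff {R : Type u} [CommRing R] [Algebra k R] (J : Ideal R)
    {Y : Over (Spec (CommRingCat.of k))} (f : Y ⟶ specOver k R) :
    (∃ h : Y ⟶ openLocus k J, h ≫ openLocusMap k J = f) ↔
      Set.range f.left ⊆ (idealOpen J : Set (Spec (CommRingCat.of R))) := by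
  constructor
  · rintro ⟨h, rfl⟩ _ ⟨x, rfl⟩
    rw [Over.comp_left, Scheme.Hom.comp_apply]
    exact (h.left x).2
  · intro hf
    have hr : Set.range f.left ⊆ Set.range (openLocusMap k J).left := by
      refine hf.trans_eq ?_
      exact (Scheme.Opens.range_ι (idealOpen J)).symm
    have hl : IsOpenImmersion.lift (openLocusMap k J).left f.left hr ≫ (openLocusMap k J).left =
        f.left := IsOpenImmersion.lift_fac _ _ hr
    refine ⟨Over.homMk (IsOpenImmersion.lift (openLocusMap k J).left f.left hr) ?_, ?_⟩
    · rw [← Over.w (openLocusMap k J), ← Category.assoc, hl, Over.w f]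
    · ext1
      exact hl

/-- The locally closed subscheme of `Spec R` cut out by equations and an open condition. -/
noncomputable abbrev locus (k : Type u) [Field k] {R : Type u} [CommRing R] [Algebra k R]
    (I J : Ideal R) : Over (Spec (CommRingCat.of k)) :=
  openLocus k (J.map (Ideal.Quotient.mk I))

/-- The immersion of a locally closed subscheme. -/
noncomputable def locusMap (k : Type u) [Field k] {R : Type u} [CommRing R] [Algebra k R]
    (I J : Ideal R) : locus k I J ⟶ specOver k R :=
  openLocusMap k (J.map (Ideal.Quotient.mk I)) ≫ specOverMap (Ideal.Quotient.mkₐ k I)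

instance {R : Type u} [CommRing R] [Algebra k R] (I J : Ideal R) :
    IsImmersion (locusMap k I J).left := by
  have : IsClosedImmersion (specOverMap (Ideal.Quotient.mkₐ k I)).left :=
    IsClosedImmersion.spec_of_surjective (CommRingCat.ofHom (Ideal.Quotient.mk I))
      Ideal.Quotient.mk_surjective
  exact IsImmersion.comp (openLocusMap k (J.map (Ideal.Quotient.mk I))).left
    (specOverMap (Ideal.Quotient.mkₐ k I)).left

/-- Lifting to the closed subscheme means that `φ` kills `I`. The resulting map from `R ⧸ I` then
lands in the open part exactly when `J` becomes the unit ideal. -/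
theorem exists_lift_locusMap_iff {R : Type u} [CommRing R] [Algebra k R] (I J : Ideal R)
    {B : Type u} [CommRing B] [Algebra k B] (φ : R →ₐ[k] B) :
    (∃ h : specOver k B ⟶ locus k I J, h ≫ locusMap k I J = specOverMap φ) ↔
      I.map (φ : R →+* B) = ⊥ ∧ J.map (φ : R →+* B) = ⊤ := by
  have key : ∀ ψ : R ⧸ I →ₐ[k] B, ψ.comp (Ideal.Quotient.mkₐ k I) = φ →
      ((∃ h : specOver k B ⟶ locus k I J, h ≫ openLocusMap k _ = specOverMap ψ) ↔
        J.map (φ : R →+* B) = ⊤) := by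
    rintro ψ rfl
    rw [exists_lift_openLocusMap_iff, specOverMap_left, range_subset_idealOpen_iff, Ideal.map_map]
    rfl
  constructor
  · rintro ⟨h, hh⟩
    obtain ⟨ψ, hψ⟩ := (specOverMap_bijective (R ⧸ I) B).2 (h ≫ openLocusMap k _)
    have hφ : ψ.comp (Ideal.Quotient.mkₐ k I) = φ := by
      apply (specOverMap_bijective R B).1
      rw [← specOverMap_comp, hψ, ← hh, Category.assoc]
      rfl
    refine ⟨?_, (key ψ hφ).1 ⟨h, hψ.symm⟩⟩
    rw [Ideal.map_eq_bot_iff_le_ker]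
    intro x hx
    rw [RingHom.mem_ker, ← hφ]
    change ψ (Ideal.Quotient.mk I x) = 0
    rw [Ideal.Quotient.eq_zero_iff_mem.2 hx, map_zero]
  · rintro ⟨hI, hJ⟩
    rw [Ideal.map_eq_bot_iff_le_ker] at hI
    let ψ : R ⧸ I →ₐ[k] B := Ideal.Quotient.liftₐ I φ fun x hx => hI hx
    have hφ : ψ.comp (Ideal.Quotient.mkₐ k I) = φ := by
      ext x
      rfl
    obtain ⟨h, hh⟩ := (key ψ hφ).2 hJ
    refine ⟨h, ?_⟩
    rw [locusMap, ← Category.assoc, hh, specOverMap_comp, hφ]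

theorem range_locusMap {R : Type u} [CommRing R] [Algebra k R] (I J : Ideal R) {p}
    (hp : p ∈ Set.range (locusMap k I J).left) :
    I ≤ PrimeSpectrum.asIdeal (R := R) p ∧ ¬ J ≤ PrimeSpectrum.asIdeal (R := R) p := by
  obtain ⟨x, rfl⟩ := hp
  have hx : (locusMap k I J).left x =
      Spec.map (CommRingCat.ofHom (Ideal.Quotient.mk I)) x.1 := by
    rw [locusMap, Over.comp_left, Scheme.Hom.comp_apply]
    rfl
  rw [hx]
  refine ⟨fun y hy => ?_, fun h => x.2 (Ideal.map_le_iff_le_comap.2 h)⟩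
  change Ideal.Quotient.mk I y ∈ (x.1 : PrimeSpectrum (R ⧸ I)).asIdeal
  rw [Ideal.Quotient.eq_zero_iff_mem.2 hy]
  exact Ideal.zero_mem _

/-- A ring map on a graded ring sending a homogeneous element `f` to `1` induces a map on the
degree zero part of the localization at `f`. -/
theorem exists_awayHom {A R : Type u} [CommRing A] [Algebra k A] [CommRing R]
    (𝒜 : ℕ → Submodule k A) [GradedAlgebra 𝒜] {f : A} {d : ℕ} (hf : f ∈ 𝒜 d) (ψ : A →+* R)
    (h : ψ f = 1) : ∃ θ : HomogeneousLocalization.Away 𝒜 f →+* R,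
      (∀ m a ha, θ (HomogeneousLocalization.Away.mk 𝒜 hf m a ha) = ψ a) ∧
      ∀ c : 𝒜 0, θ (algebraMap (𝒜 0) _ c) = ψ c := by
  have hu : IsUnit (ψ f) := by
    rw [h]
    exact isUnit_one
  refine ⟨(IsLocalization.Away.lift (S := Localization.Away f) f hu).comp
      (algebraMap (HomogeneousLocalization.Away 𝒜 f) (Localization.Away f)), ?_, ?_⟩
  · intro m a ha
    rw [RingHom.comp_apply, HomogeneousLocalization.algebraMap_apply,
      HomogeneousLocalization.Away.val_mk, Localization.mk_eq_mk', IsLocalization.Away.lift,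
      IsLocalization.lift_mk'_spec]
    simp [h]
  · intro c
    rw [RingHom.comp_apply, HomogeneousLocalization.algebraMap_apply,
      HomogeneousLocalization.algebraMap_eq]
    change IsLocalization.Away.lift f hu (Localization.mk _ 1) = _
    rw [Localization.mk_eq_mk', IsLocalization.Away.lift, IsLocalization.lift_mk'_spec]
    simp

/-- An affine scheme of finite type is quasi-projective. -/
theorem isQuasiProjective_specOver (R : Type u) [CommRing R] [Algebra k R]
    [Algebra.FiniteType k R] : IsQuasiProjective (specOver k R) := by
  obtain ⟨N, π, hπ⟩ := Algebra.FiniteType.iff_quotient_mvPolynomial''.1 ‹_›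
  let 𝒜 := MvPolynomial.homogeneousSubmodule (Fin (N + 1)) k
  let x₀ : MvPolynomial (Fin (N + 1)) k := MvPolynomial.X 0
  have hx₀ : x₀ ∈ 𝒜 1 := MvPolynomial.isHomogeneous_X k 0
  -- Dehomogenization: the first coordinate goes to 1 and the others to algebra generators of `R`,
  -- which realizes `Spec R` as a closed subscheme of the standard chart.
  let ψ : MvPolynomial (Fin (N + 1)) k →ₐ[k] R :=
    MvPolynomial.aeval (Fin.cons 1 fun i => π (MvPolynomial.X i))
  have hψ : ψ x₀ = 1 := by simp [ψ, x₀]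
  have hψX : ∀ i : Fin N, ψ (MvPolynomial.X i.succ) = π (MvPolynomial.X i) := fun i => by simp [ψ]
  obtain ⟨θ, hθ, hθ₀⟩ := exists_awayHom 𝒜 hx₀ (ψ : MvPolynomial (Fin (N + 1)) k →+* R) hψ
  have hk : ∀ c : k, θ (algebraMap (𝒜 0) _ (algebraMap k (𝒜 0) c)) = algebraMap k R c := by
    intro c
    rw [hθ₀]
    exact ψ.commutes c
  have hsurj : Function.Surjective θ := by
    intro y
    obtain ⟨p, rfl⟩ := hπ y
    change π p ∈ θ.range
    induction p using MvPolynomial.induction_on with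
    | C c => exact ⟨_, (hk c).trans (π.commutes c).symm⟩
    | add p q hp hq =>
      rw [map_add]
      exact add_mem hp hq
    | mul_X p i hp =>
      rw [map_mul]
      -- The generator is the image of the degree zero fraction with numerator the corresponding
      -- variable and denominator `x₀`.
      refine mul_mem hp ⟨HomogeneousLocalization.Away.mk 𝒜 hx₀ 1 (MvPolynomial.X i.succ) ?_, ?_⟩
      · rw [one_smul]
        exact MvPolynomial.isHomogeneous_X k i.succ
      · rw [hθ]
        exact hψX i
  have hc : IsClosedImmersion (Spec.map (CommRingCat.ofHom θ)) :=
    IsClosedImmersion.spec_of_surjective (CommRingCat.ofHom θ) hsurj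
  refine ⟨N, Over.homMk (U := specOver k R) (V := projSpace k N)
    (Spec.map (CommRingCat.ofHom θ) ≫ Proj.awayι 𝒜 x₀ hx₀ one_pos) ?_, ?_⟩
  · change (Spec.map (CommRingCat.ofHom θ) ≫ Proj.awayι 𝒜 x₀ hx₀ one_pos) ≫
      Proj.toSpecZero 𝒜 ≫ Spec.map (CommRingCat.ofHom (algebraMap k (𝒜 0))) =
      Spec.map (CommRingCat.ofHom (algebraMap k R))
    rw [Category.assoc, Proj.awayι_toSpecZero_assoc, ← Spec.map_comp, ← Spec.map_comp,
      ← CommRingCat.ofHom_comp, ← CommRingCat.ofHom_comp]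
    congr 2
    exact RingHom.ext hk
  · exact IsImmersion.comp (Spec.map (CommRingCat.ofHom θ)) (Proj.awayι 𝒜 x₀ hx₀ one_pos)

end Schemes
end NilpRep

namespace NilpRep

/-! ### Assembling the representing schemes -/

section Representability

variable {k : Type u} [Field k] {g : Type v} [LieRing g] [LieAlgebra k g]

theorem IsNondeg.isFlag {n : ℕ} {A E : Type u} [CommRing A] [Algebra k A] [AddCommGroup E]
    [Module A E] [Module k E] [IsScalarTower k A E] {ρ : g →ₗ⁅k⁆ Module.End A E}
    (h : IsNondeg k g n A E ρ) : IsFlag n ρ := by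
  cases n with
  | zero => exact h.1
  | succ n => exact h.1

/-- A universal point over `R` makes `Spec R` represent the functor `Hom_Lie(g, n_n)`. -/
noncomputable def homPtsRepr {n : ℕ} {R : Type u} [CommRing R] [Algebra k R] (r : HomPts k g n R)
    (hr : ∀ (B : Type u) [CommRing B] [Algebra k B],
      Function.Bijective fun φ : R →ₐ[k] B => r.map φ) : HomPtsRepr g n (specOver k R) where
  equiv B _ _ := (Equiv.ofBijective _ (specOverMap_bijective R B)).symm.trans
    (Equiv.ofBijective _ (hr B))
  naturality B C _ _ _ _ φ f := by
    obtain ⟨ψ, rfl⟩ := (specOverMap_bijective R B).2 f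
    have h : ∀ (D : Type u) [CommRing D] [Algebra k D] (χ : R →ₐ[k] D),
        (Equiv.ofBijective _ (specOverMap_bijective R D)).symm (specOverMap χ) = χ :=
      fun D _ _ χ => (Equiv.ofBijective _ (specOverMap_bijective R D)).symm_apply_apply χ
    rw [specOverMap_comp, Equiv.trans_apply, Equiv.trans_apply, h, h]
    exact (map_map ..).symm

theorem homPtsRepr_equiv {n : ℕ} {R : Type u} [CommRing R] [Algebra k R] (r : HomPts k g n R)
    (hr : ∀ (B : Type u) [CommRing B] [Algebra k B],
      Function.Bijective fun φ : R →ₐ[k] B => r.map φ)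
    (B : Type u) [CommRing B] [Algebra k B] (φ : R →ₐ[k] B) :
    (homPtsRepr r hr).equiv B (specOverMap φ) = r.map φ := by
  change Equiv.ofBijective _ (hr B)
    ((Equiv.ofBijective _ (specOverMap_bijective R B)).symm (specOverMap φ)) = _
  rw [show (Equiv.ofBijective _ (specOverMap_bijective R B)).symm (specOverMap φ) = φ from
    (Equiv.ofBijective _ (specOverMap_bijective R B)).symm_apply_apply φ]
  rfl

/-- An ideal cutting out only flag points has its nonvanishing part inside the flag locus. -/
theorem range_locusMap_subset {n : ℕ} {R : Type u} [CommRing R] [Algebra k R]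
    (r : HomPts k g n R) (I J : Ideal R)
    (hIJ : ∀ (C : Type u) [CommRing C] [Algebra k C] (φ : R →ₐ[k] C),
      IsNondeg k g n C (Fin n → C) (r.map φ).toRep ↔
        I.map (φ : R →+* C) = ⊥ ∧ J.map (φ : R →+* C) = ⊤) :
    Set.range (locusMap k I J).left ⊆
      (idealOpen (flagIdeal r) : Set (Spec (CommRingCat.of R))) := by
  intro p hp
  obtain ⟨hI, hJ⟩ := range_locusMap I J hp
  let q : PrimeSpectrum R := p
  change I ≤ q.asIdeal at hI
  change ¬ J ≤ q.asIdeal at hJ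
  change ¬ flagIdeal r ≤ q.asIdeal
  let φ : R →ₐ[k] q.asIdeal.ResidueField := IsScalarTower.toAlgHom k R q.asIdeal.ResidueField
  have hker : ∀ K : Ideal R, K.map (φ : R →+* q.asIdeal.ResidueField) = ⊥ ↔ K ≤ q.asIdeal := by
    intro K
    rw [Ideal.map_eq_bot_iff_le_ker]
    change K ≤ RingHom.ker (algebraMap R q.asIdeal.ResidueField) ↔ _
    rw [Ideal.ker_algebraMap_residueField]
  -- The tautological point over the residue field satisfies both ideal conditions, hence is
  -- nondegenerate and in particular flag. In a field, an ideal that is not zero is the unit ideal.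
  have hn : IsNondeg k g n q.asIdeal.ResidueField _ (r.map φ).toRep :=
    (hIJ _ φ).2 ⟨(hker I).2 hI,
      (Ideal.eq_bot_or_top _).resolve_left fun h => hJ ((hker J).1 h)⟩
  have ht := (map_flagIdeal_eq_top_iff r φ).2 ((isFlag_iff _).1 hn.isFlag)
  intro hle
  exact bot_ne_top (((hker _).2 hle).symm.trans ht)

end Representability

end NilpRep

theorem proposition6 {k : Type u} [Field k] {g : Type v} [LieRing g] [LieAlgebra k g]
    (hg : ∃ s : Finset g, LieSubalgebra.lieSpan k g (s : Set g) = ⊤) (n : ℕ) :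
    ∃ (X : Over (Spec (CommRingCat.of k))) (α : NilpRep.HomPtsRepr g n X)
      (Xfl : Over (Spec (CommRingCat.of k))) (j : Xfl ⟶ X)
      (Xnd : Over (Spec (CommRingCat.of k))) (i : Xnd ⟶ Xfl),
      (IsOpenImmersion j.left ∧
        NilpRep.RepresentsLocus j
          (fun B _ _ f => NilpRep.IsFlag n (NilpRep.HomPts.toRep (α.equiv B f)))) ∧
      (IsImmersion i.left ∧
        NilpRep.RepresentsLocus i
          (fun B _ _ f => NilpRep.IsNondeg k g n B (Fin n → B)
            (NilpRep.HomPts.toRep (α.equiv B (f ≫ j))))) ∧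
      NilpRep.IsQuasiProjective Xnd := by
  obtain ⟨R, _, _, _, r, hr⟩ := NilpRep.exists_universal hg n
  obtain ⟨s, hs⟩ := hg
  obtain ⟨I, J, hIJ⟩ := NilpRep.exists_ideals_isNondeg (k := k) (S := s) (s := fun x => (x : g))
    (by simpa using hs) r
  -- The nondegenerate locus is first built inside `Spec R`; its points are flag, so its immersion
  -- factors through the open flag locus.
  obtain ⟨i, hi⟩ := (NilpRep.exists_lift_openLocusMap_iff (NilpRep.flagIdeal r)
    (NilpRep.locusMap k I J)).2 (NilpRep.range_locusMap_subset r I J hIJ)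
  have hi' : i.left ≫ (NilpRep.openLocusMap k (NilpRep.flagIdeal r)).left =
      (NilpRep.locusMap k I J).left := by rw [← Over.comp_left, hi]
  refine ⟨NilpRep.specOver k R, NilpRep.homPtsRepr r hr,
    NilpRep.openLocus k (NilpRep.flagIdeal r), NilpRep.openLocusMap k _,
    NilpRep.locus k I J, i, ⟨inferInstance, ?_⟩, ⟨?_, ?_⟩, ?_⟩
  · intro B _ _ f
    obtain ⟨φ, rfl⟩ := (NilpRep.specOverMap_bijective R B).2 f
    beta_reduce
    rw [NilpRep.homPtsRepr_equiv, NilpRep.isFlag_iff, ← NilpRep.map_flagIdeal_eq_top_iff,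
      NilpRep.exists_lift_openLocusMap_iff, NilpRep.specOverMap_left]
    exact (NilpRep.range_subset_idealOpen_iff _ _).symm
  -- The composite with the open immersion into `Spec R` is an immersion, and this passes to the
  -- first factor.
  · have : IsImmersion (i.left ≫ (NilpRep.openLocusMap k (NilpRep.flagIdeal r)).left) := by
      rw [hi']
      infer_instance
    exact IsImmersion.of_comp i.left (NilpRep.openLocusMap k (NilpRep.flagIdeal r)).left
  · intro B _ _ f
    obtain ⟨φ, hφ⟩ := (NilpRep.specOverMap_bijective R B).2
      (f ≫ NilpRep.openLocusMap k (NilpRep.flagIdeal r))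
    beta_reduce
    rw [← hφ, NilpRep.homPtsRepr_equiv, hIJ, ← NilpRep.exists_lift_locusMap_iff]
    -- Lifts through `i` and lifts through the immersion into `Spec R` agree because the open
    -- immersion is a monomorphism.
    refine exists_congr fun h => ⟨fun hh => ?_, fun hh => ?_⟩
    · ext1
      rw [← cancel_mono (NilpRep.openLocusMap k (NilpRep.flagIdeal r)).left, ← Over.comp_left,
        ← Over.comp_left, Category.assoc, hi, hh, hφ]
    · rw [hφ, ← hh, Category.assoc, hi]
  · obtain ⟨N, e, _⟩ := NilpRep.isQuasiProjective_specOver (k := k) R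
    refine ⟨N, NilpRep.locusMap k I J ≫ e, ?_⟩
    exact IsImmersion.comp (NilpRep.locusMap k I J).left e.left
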